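/- Let $\mathbb{H}$ be the upper half plane with the hyperbolic metric $d$ and ideal boundary $\widehat{\mathbb{R}}=\mathbb{R}\cup\{\infty\}$. For $A,B>0$, a homeomorphism $f:\mathbb{H}\to\mathbb{H}$ is an $(A,B)$-quasi-isometry if $$A^{-1}d(x,y)-B\le d(f(x),f(y))\le A\,d(x,y)+B\qquad\text{for all }x,y\in\mathbb{H},$$ and a quasi-isometry if it is one for some $A,B>0$. Every quasi-isometry extends continuously to a homeomorphism of $\widehat{\mathbb{R}}$, its boundary map. Let $\mathrm{QI}(\mathbb{H})$ be the group, under composition, of orientation-preserving homeomorphisms of $\mathbb{H}$ that are quasi-isometries, modulo the relation of having the same boundary map. Regard $\mathrm{PSL}(2,\mathbb{R})=\{z\mapsto\frac{az+b}{cz+d}:a,b,c,d\in\mathbb{R},\ ad-bc=1\}$ as a subgroup of $\mathrm{QI}(\mathbb{H})$ through the natural map. A subgroup $G\le\mathrm{QI}(\mathbb{H})$ is a uniform quasi-isometry group if there are constants $A,B>0$ such that every class in $G$ contains an $(A,B)$-quasi-isometry. If $G\le\mathrm{QI}(\mathbb{H})$ is a uniform quasi-isometry group and $\mathrm{PSL}(2,\mathbb{R})\le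 G$, then $G=\mathrm{PSL}(2,\mathbb{R})$. -/

import Mathlib

open UpperHalfPlane Filter Topology

/-- `f : ℍ → ℍ` satisfies the two-sided quasi-isometry inequality with multiplicative (Lipschitz)
constant `A` and additive constant `B`, for the hyperbolic metric on the upper half plane. -/
def QuasiIsometryWith (A B : ℝ) (f : ℍ → ℍ) : Prop :=
  ∀ x y : ℍ, A⁻¹ * dist x y - B ≤ dist (f x) (f y) ∧ dist (f x) (f y) ≤ A * dist x y + B

/-- `f` is a quasi-isometry: the inequality holds for some positive constants. -/
def IsQuasiIsometry (f : ℍ → ℍ) : Prop :=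
  ∃ A B : ℝ, 0 < A ∧ 0 < B ∧ QuasiIsometryWith A B f

/-- The path `γ` in the upper half plane avoids `z`, is closed, and has winding number `n` around
`z`: a continuous branch `θ` of `log (γ - z)` along `γ` increases by `2 π i n`. -/
def HasWindingNumber (γ : C(unitInterval, ℍ)) (z : ℍ) (n : ℤ) : Prop :=
  ∃ θ : C(unitInterval, ℂ), (∀ t, Complex.exp (θ t) = (γ t : ℂ) - (z : ℂ)) ∧
    θ 1 - θ 0 = n * (2 * Real.pi * Complex.I)

/-- A homeomorphism of the upper half plane is orientation preserving if it has degree `+1` at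
every point, that is, if it preserves winding numbers of closed paths around points. -/
def OrientationPreserving (f : ℍ ≃ₜ ℍ) : Prop :=
  ∀ (γ : C(unitInterval, ℍ)) (z : ℍ) (n : ℤ),
    HasWindingNumber γ z n ↔ HasWindingNumber ((f : C(ℍ, ℍ)).comp γ) (f z) n

theorem IsQuasiIsometry.comp {f g : ℍ → ℍ} (hf : IsQuasiIsometry f) (hg : IsQuasiIsometry g) :
    IsQuasiIsometry (f ∘ g) := by
  obtain ⟨A, B, hA, hB, h⟩ := hf
  obtain ⟨A', B', hA', hB', h'⟩ := hg
  refine ⟨A * A', A * B' + A⁻¹ * B' + B, by positivity, by positivity, fun x y => ?_⟩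
  obtain ⟨h1, h2⟩ := h (g x) (g y)
  obtain ⟨h3, h4⟩ := h' x y
  have hAi : 0 < A⁻¹ := inv_pos.mpr hA
  have h5 := mul_le_mul_of_nonneg_left h3 hAi.le
  have h6 := mul_le_mul_of_nonneg_left h4 hA.le
  have h7 : 0 < A * B' := by positivity
  have h8 : 0 < A⁻¹ * B' := by positivity
  simp only [Function.comp_apply, mul_inv]
  constructor <;> nlinarith

theorem IsQuasiIsometry.symm {f : ℍ ≃ₜ ℍ} (hf : IsQuasiIsometry f) :
    IsQuasiIsometry f.symm := by
  obtain ⟨A, B, hA, hB, h⟩ := hf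
  refine ⟨A, A * B + A⁻¹ * B, hA, by positivity, fun x y => ?_⟩
  obtain ⟨h1, h2⟩ := h (f.symm x) (f.symm y)
  simp only [Homeomorph.apply_symm_apply] at h1 h2
  have hAi : 0 < A⁻¹ := inv_pos.mpr hA
  have h5 := mul_le_mul_of_nonneg_left h1 hA.le
  have h6 := mul_le_mul_of_nonneg_left h2 hAi.le
  rw [mul_sub, ← mul_assoc, mul_inv_cancel₀ hA.ne', one_mul] at h5
  rw [mul_add, ← mul_assoc, inv_mul_cancel₀ hA.ne', one_mul] at h6
  have h7 : 0 < A * B := by positivity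
  have h8 : 0 < A⁻¹ * B := by positivity
  constructor <;> linarith

theorem OrientationPreserving.mul {f g : ℍ ≃ₜ ℍ} (hf : OrientationPreserving f)
    (hg : OrientationPreserving g) : OrientationPreserving (f * g) :=
  fun γ z n => (hg γ z n).trans (hf ((g : C(ℍ, ℍ)).comp γ) (g z) n)

theorem OrientationPreserving.inv {f : ℍ ≃ₜ ℍ} (hf : OrientationPreserving f) :
    OrientationPreserving f⁻¹ := by
  intro γ z n
  have h := hf (((f⁻¹ : ℍ ≃ₜ ℍ) : C(ℍ, ℍ)).comp γ) (f⁻¹ z) n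
  have h1 : f (f⁻¹ z) = z := f.apply_symm_apply z
  have h2 : (f : C(ℍ, ℍ)).comp (((f⁻¹ : ℍ ≃ₜ ℍ) : C(ℍ, ℍ)).comp γ) = γ := by
    ext1 t
    exact f.apply_symm_apply (γ t)
  rw [h1, h2] at h
  exact h.symm

/-- The group of orientation preserving homeomorphisms of the hyperbolic plane that are
quasi-isometries. -/
def QIHomeo : Subgroup (ℍ ≃ₜ ℍ) where
  carrier := {f | OrientationPreserving f ∧ IsQuasiIsometry f}
  mul_mem' := fun ha hb => ⟨ha.1.mul hb.1, ha.2.comp hb.2⟩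
  one_mem' := ⟨fun _ _ _ => Iff.rfl, 1, 1, one_pos, one_pos, fun x y => by
    simp only [Homeomorph.one_apply]; constructor <;> linarith⟩
  inv_mem' := fun ha => ⟨ha.1.inv, ha.2.symm⟩

/-- The homeomorphism `f` of the upper half plane extends continuously to the ideal boundary
`ℝ ∪ {∞}` by the map `h`. The topology on `ℍ ∪ (ℝ ∪ {∞})` is that of the closed half plane
together with `∞`, as a subspace of the Riemann sphere `ℂ ∪ {∞}`. -/
def InducesOnBoundary (f : ℍ ≃ₜ ℍ) (h : OnePoint ℝ ≃ₜ OnePoint ℝ) : Prop :=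
  ∀ ξ : OnePoint ℝ,
    Tendsto (fun z : ℍ => ((f z : ℂ) : OnePoint ℂ))
      (comap (fun z : ℍ => ((z : ℂ) : OnePoint ℂ)) (𝓝 (OnePoint.map Complex.ofReal ξ)))
      (𝓝 (OnePoint.map Complex.ofReal (h ξ)))

/-- `f` and `g` induce the same homeomorphism of the ideal boundary. -/
def SameBoundaryMap (f g : QIHomeo) : Prop :=
  ∃ h : OnePoint ℝ ≃ₜ OnePoint ℝ, InducesOnBoundary f h ∧ InducesOnBoundary g h

/-- The congruence identifying quasi-isometries with the same boundary map. Every element of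
`QIHomeo` induces a homeomorphism of the ideal boundary, so that `SameBoundaryMap` already is a
congruence and coincides with the congruence it generates; taking the generated congruence only
makes the group structure on the quotient available without having to prove that fact first. -/
noncomputable def boundaryCon : Con QIHomeo := conGen SameBoundaryMap

/-- The quasi-isometry group of the hyperbolic plane: quasi-isometries modulo equality of their
boundary maps, with the group structure given by composition. -/
abbrev QI : Type := boundaryCon.Quotient

/-- The class of a quasi-isometry. -/
noncomputable def QI.mk : QIHomeo →* QI := boundaryCon.mk'

/-- The action of `SL(2, ℝ)` on the upper half plane by `z ↦ (a z + b) / (c z + d)`. -/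
noncomputable def moebiusHomeo : Matrix.SpecialLinearGroup (Fin 2) ℝ →* (ℍ ≃ₜ ℍ) where
  toFun g := Homeomorph.smul g
  map_one' := by ext1 z; exact one_smul (Matrix.SpecialLinearGroup (Fin 2) ℝ) z
  map_mul' g h := by ext1 z; exact mul_smul g h z

theorem moebius_sub (g : Matrix.SpecialLinearGroup (Fin 2) ℝ) (z w : ℍ) :
    ((g • z : ℍ) : ℂ) - ((g • w : ℍ) : ℂ) =
      ((z : ℂ) - w) / ((g 1 0 * z + g 1 1) * (g 1 0 * w + g 1 1)) := by
  have hz : (g 1 0 * z + g 1 1 : ℂ) ≠ 0 := denom_ne_zero (g : GL (Fin 2) ℝ) z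
  have hw : (g 1 0 * w + g 1 1 : ℂ) ≠ 0 := denom_ne_zero (g : GL (Fin 2) ℝ) w
  have hd : (g 0 0 * g 1 1 - g 0 1 * g 1 0 : ℂ) = 1 := by
    have := g.det_coe
    rw [Matrix.det_fin_two] at this
    exact_mod_cast this
  rw [coe_specialLinearGroup_apply, coe_specialLinearGroup_apply]
  simp only [Algebra.algebraMap_self, RingHom.id_apply]
  rw [div_sub_div _ _ hz hw]
  congr 1
  linear_combination ((z : ℂ) - w) * hd

theorem moebius_denom_log (g : Matrix.SpecialLinearGroup (Fin 2) ℝ) :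
    ∃ l : C(ℍ, ℂ), ∀ z : ℍ, Complex.exp (l z) = g 1 0 * z + g 1 1 := by
  have hne : ∀ z : ℍ, (g 1 0 * z + g 1 1 : ℂ) ≠ 0 := fun z => denom_ne_zero (g : GL (Fin 2) ℝ) z
  by_cases hc : g 1 0 = 0
  · refine ⟨ContinuousMap.const _ (Complex.log (g 1 1)), fun z => ?_⟩
    have := hne z
    simp only [hc, Complex.ofReal_zero, zero_mul, zero_add] at this ⊢
    exact Complex.exp_log this
  · refine ⟨⟨fun z => Complex.log (g 1 0 * z + g 1 1), ?_⟩, fun z => Complex.exp_log (hne z)⟩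
    refine Continuous.clog (by fun_prop) fun z => Or.inr ?_
    simpa using ⟨hc, z.im_ne_zero⟩

theorem moebius_winding (g : Matrix.SpecialLinearGroup (Fin 2) ℝ) {γ : C(unitInterval, ℍ)} {z : ℍ}
    {n : ℤ} (h : HasWindingNumber γ z n) :
    HasWindingNumber ((moebiusHomeo g : C(ℍ, ℍ)).comp γ) (moebiusHomeo g z) n := by
  obtain ⟨θ, h1, h2⟩ := h
  obtain ⟨l, hl⟩ := moebius_denom_log g
  have hγ : γ 1 = γ 0 := by
    apply UpperHalfPlane.ext
    have e : Complex.exp (θ 1) = Complex.exp (θ 0) :=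
      Complex.exp_eq_exp_iff_exists_int.mpr ⟨n, by linear_combination h2⟩
    rw [h1, h1] at e
    exact sub_left_injective e
  refine ⟨θ - l.comp γ - ContinuousMap.const _ (l z), fun t => ?_, ?_⟩
  · have e := moebius_sub g (γ t) z
    refine Eq.trans ?_ e.symm
    simp only [ContinuousMap.sub_apply, ContinuousMap.comp_apply, ContinuousMap.const_apply,
      Complex.exp_sub, h1, hl, div_div]
  · simp only [ContinuousMap.sub_apply, ContinuousMap.comp_apply, ContinuousMap.const_apply, hγ]
    linear_combination h2

theorem moebius_mem (g : Matrix.SpecialLinearGroup (Fin 2) ℝ) : moebiusHomeo g ∈ QIHomeo := by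
  refine ⟨fun γ z n => ⟨moebius_winding g, fun h => ?_⟩, 1, 1, one_pos, one_pos, fun x y => ?_⟩
  · have h' := moebius_winding g⁻¹ h
    have e1 : moebiusHomeo g⁻¹ (moebiusHomeo g z) = z := inv_smul_smul g z
    have e2 : (moebiusHomeo g⁻¹ : C(ℍ, ℍ)).comp ((moebiusHomeo g : C(ℍ, ℍ)).comp γ) = γ := by
      ext1 t
      exact inv_smul_smul g (γ t)
    rwa [e1, e2] at h'
  · have e : dist (moebiusHomeo g x) (moebiusHomeo g y) = dist x y := dist_smul g x y
    rw [e]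
    constructor <;> linarith

/-- The image in `QI` of `PSL(2, ℝ)`, the group of transformations `z ↦ (a z + b) / (c z + d)`
with `a, b, c, d` real and `a d - b c = 1`. -/
noncomputable def PSL2R : Subgroup QI := (QI.mk.comp (moebiusHomeo.codRestrict QIHomeo moebius_mem)).range

/-- `G` is a uniform quasi-isometry group: there are constants `A` and `B` such that every class
in `G` is represented by a quasi-isometry with constants `A` and `B`. -/
def IsUniformQIGroup (G : Subgroup QI) : Prop :=
  ∃ A B : ℝ, 0 < A ∧ 0 < B ∧ ∀ x ∈ G, ∃ f : QIHomeo, QI.mk f = x ∧ QuasiIsometryWith A B f.1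

/-! Two classes in `QI` agree exactly when their boundary maps agree, so it is enough to show that
every boundary map of `G` is that of a Möbius transformation. After composition with a Möbius
transformation, which stays inside `G`, an element fixes `0`, `1` and `∞` and acts on the real line
by an increasing homeomorphism `φ`. The claim becomes `φ = id`.

Suppose that `φ` moves some point `t`. Then the iterates of `φ` or of its inverse carry some point
monotonically to a fixed point `p` without reaching it. One of `0`, `1` is a fixed point `a`
different from `p`. Thus the interval between `p` and `a` keeps its length under all iterates, while
the one between `p` and `t` shrinks to nothing. This is impossible for uniform quasi-isometries: the
height of the image of a point above an interval is comparable to the length of the image interval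
(`exists_im_map_bounds`), and images of two fixed points remain at bounded distance, so their
heights have bounded ratio (`UniformPowers.not_tendsto`).

The comparison of heights says that a quasi-isometry fixing `0`, `1`, `∞` moves the point `i` to
bounded height, above and below. It rests on the stability of quasi-geodesics, in the form that
quasi-isometries distort Gromov products by a controlled amount (`exists_segDist_le`,
`exists_defect_map_le`). The same fact yields the extension to the boundary
(`exists_tendsto_idealNhds`). That `φ` increases is where orientation enters: a decreasing `φ` would
make large circles wind the wrong way (`not_strictAnti_of_map_zero`). -/

/-! ### The imaginary axis and moving points onto it -/

/-- The point `i exp s` of the imaginary axis. -/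
noncomputable def axisPoint (s : ℝ) : ℍ := ⟨⟨0, Real.exp s⟩, Real.exp_pos s⟩

@[simp] theorem axisPoint_re (s : ℝ) : (axisPoint s).re = 0 := rfl

@[simp] theorem axisPoint_im (s : ℝ) : (axisPoint s).im = Real.exp s := rfl

theorem coe_axisPoint (s : ℝ) : (axisPoint s : ℂ) = Real.exp s * Complex.I := by
  apply Complex.ext
  · simp [axisPoint, -Complex.ofReal_exp]
  · simp [axisPoint, -Complex.ofReal_exp]

theorem dist_axisPoint (s t : ℝ) : dist (axisPoint s) (axisPoint t) = |s - t| := by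
  rw [dist_of_re_eq (by simp)]
  simp [Real.dist_eq]

/-- The elliptic element `z ↦ -1 / z` of `SL(2, ℝ)`. -/
def inversion : Matrix.SpecialLinearGroup (Fin 2) ℝ := ⟨!![0, -1; 1, 0], by simp⟩

theorem coe_inversion_smul (z : ℍ) : ((inversion • z : ℍ) : ℂ) = -1 / z := by
  rw [coe_specialLinearGroup_apply]
  simp [inversion]

theorem coe_toSL2R_smul (a z : ℍ) : ((a.toSL2R • z : ℍ) : ℂ) = a.im * z + a.re := by
  rw [coe_specialLinearGroup_apply]
  have h : (√a.im : ℂ) ≠ 0 := by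
    exact_mod_cast (Real.sqrt_pos.mpr a.im_pos).ne'
  have h2 : (√a.im : ℂ) * √a.im = a.im := by
    exact_mod_cast Real.mul_self_sqrt a.im_pos.le
  simp only [coe_toSL2R]
  simp
  field_simp
  linear_combination (z : ℂ) * h2

/-- Rotation by `2 θ` around `i`. -/
noncomputable def ellipticRotation (θ : ℝ) : Matrix.SpecialLinearGroup (Fin 2) ℝ :=
  ⟨!![Real.cos θ, Real.sin θ; -Real.sin θ, Real.cos θ], by
    rw [Matrix.det_fin_two_of]; nlinarith [Real.sin_sq_add_cos_sq θ]⟩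

theorem coe_ellipticRotation_smul (θ : ℝ) (z : ℍ) : ((ellipticRotation θ • z : ℍ) : ℂ) =
    (Real.cos θ * z + Real.sin θ) / (-Real.sin θ * z + Real.cos θ) := by
  rw [coe_specialLinearGroup_apply]
  simp [ellipticRotation]

theorem ellipticRotation_denom_ne_zero (θ : ℝ) (z : ℍ) :
    (-Real.sin θ * z + Real.cos θ : ℂ) ≠ 0 := by
  have h : (ellipticRotation θ 1 0 * z + ellipticRotation θ 1 1 : ℂ) ≠ 0 :=
    denom_ne_zero (ellipticRotation θ : GL (Fin 2) ℝ) z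
  simpa [ellipticRotation] using h

theorem ellipticRotation_smul_I (θ : ℝ) : ellipticRotation θ • (I : ℍ) = I := by
  apply UpperHalfPlane.ext
  have h := ellipticRotation_denom_ne_zero θ I
  rw [coe_ellipticRotation_smul, div_eq_iff h, coe_I]
  linear_combination (Real.sin θ : ℂ) * Complex.I_mul_I

theorem continuous_ellipticRotation_smul (z : ℍ) :
    Continuous fun θ : ℝ => ellipticRotation θ • z := by
  rw [UpperHalfPlane.isEmbedding_coe.continuous_iff]
  have : (UpperHalfPlane.coe ∘ fun θ : ℝ => ellipticRotation θ • z) = fun θ : ℝ =>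
      (Real.cos θ * z + Real.sin θ : ℂ) / (-Real.sin θ * z + Real.cos θ) := by
    ext θ; exact coe_ellipticRotation_smul θ z
  rw [this]
  refine Continuous.div ?_ ?_ fun θ => ellipticRotation_denom_ne_zero θ z
  · fun_prop
  · fun_prop

theorem exists_ellipticRotation_smul_re_eq_zero (z : ℍ) :
    ∃ θ : ℝ, (ellipticRotation θ • z).re = 0 := by
  have hc : Continuous fun θ : ℝ => (ellipticRotation θ • z).re :=
    continuous_re.comp (continuous_ellipticRotation_smul z)
  have h0 : (ellipticRotation 0 • z).re = z.re := by
    rw [← coe_re, coe_ellipticRotation_smul]; simp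
  -- A quarter period gives `-1 / z`, up to sign conventions a half turn, which reverses the sign of
  -- the real part; the intermediate value theorem then applies.
  have h1 : (ellipticRotation (Real.pi / 2) • z).re = -z.re / Complex.normSq z := by
    rw [← coe_re, coe_ellipticRotation_smul]
    simp [Complex.inv_re, neg_div]
  have hn : 0 < Complex.normSq (z : ℂ) := Complex.normSq_pos.mpr z.ne_zero
  rcases le_total 0 z.re with h | h
  · obtain ⟨θ, -, hθ⟩ := intermediate_value_uIcc (hc.continuousOn (s := Set.uIcc 0 (Real.pi / 2)))
      (show (0 : ℝ) ∈ _ by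
        rw [h0, h1]
        exact Set.mem_uIcc.mpr (Or.inr ⟨div_nonpos_of_nonpos_of_nonneg (by linarith) hn.le, h⟩))
    exact ⟨θ, hθ⟩
  · obtain ⟨θ, -, hθ⟩ := intermediate_value_uIcc (hc.continuousOn (s := Set.uIcc 0 (Real.pi / 2)))
      (show (0 : ℝ) ∈ _ by
        rw [h0, h1]
        exact Set.mem_uIcc.mpr (Or.inl ⟨h, div_nonneg (by linarith) hn.le⟩))
    exact ⟨θ, hθ⟩

theorem eq_axisPoint {z : ℍ} (h : z.re = 0) : z = axisPoint (Real.log z.im) := by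
  apply UpperHalfPlane.ext
  apply Complex.ext
  · simpa using h
  · simp [Real.exp_log z.im_pos]

/-- Any two points can be moved to the upper half of the imaginary axis. -/
theorem exists_smul_eq_axisPoint (z w : ℍ) :
    ∃ (g : Matrix.SpecialLinearGroup (Fin 2) ℝ) (s t : ℝ), s ≤ t ∧
      g • z = axisPoint s ∧ g • w = axisPoint t := by
  obtain ⟨g, hg⟩ := MulAction.exists_smul_eq (Matrix.SpecialLinearGroup (Fin 2) ℝ) z (I : ℍ)
  obtain ⟨θ, hθ⟩ := exists_ellipticRotation_smul_re_eq_zero (g • w)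
  have hI : (I : ℍ) = axisPoint 0 := by
    apply UpperHalfPlane.ext; simp [coe_axisPoint]
  have hz : (ellipticRotation θ * g) • z = axisPoint 0 := by
    rw [mul_smul, hg, ellipticRotation_smul_I, hI]
  have hw := eq_axisPoint hθ
  rw [← mul_smul] at hw
  set t := Real.log ((ellipticRotation θ * g) • w).im
  have hinv : ∀ u, inversion • axisPoint u = axisPoint (-u) := by
    intro u
    apply UpperHalfPlane.ext
    rw [coe_inversion_smul, coe_axisPoint, coe_axisPoint, Real.exp_neg]
    have : (Real.exp u : ℂ) ≠ 0 := by exact_mod_cast (Real.exp_pos u).ne'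
    push_cast
    field_simp
    simp
  rcases le_total 0 t with h | h
  · exact ⟨_, 0, t, h, hz, hw⟩
  · refine ⟨inversion * (ellipticRotation θ * g), 0, -t, by linarith, ?_, ?_⟩
    · rw [mul_smul, hz, hinv, neg_zero]
    · rw [mul_smul, hw, hinv]

/-! ### Projection to the imaginary axis and to its segments -/

/-- Logarithm of the modulus: the position of the projection to the imaginary axis. -/
noncomputable def axisProj (z : ℍ) : ℝ := Real.log ‖(z : ℂ)‖

theorem norm_coe_pos (z : ℍ) : 0 < ‖(z : ℂ)‖ := norm_pos_iff.mpr z.ne_zero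

theorem exp_axisProj (z : ℍ) : Real.exp (axisProj z) = ‖(z : ℂ)‖ := Real.exp_log (norm_coe_pos z)

theorem im_le_norm (z : ℍ) : z.im ≤ ‖(z : ℂ)‖ := (le_abs_self _).trans (Complex.abs_im_le_norm _)

theorem cosh_dist_axisPoint_axisProj (z : ℍ) :
    Real.cosh (dist z (axisPoint (axisProj z))) = ‖(z : ℂ)‖ / z.im := by
  rw [cosh_dist, axisPoint_im, exp_axisProj, Complex.dist_eq]
  have h1 := Complex.sq_norm (z : ℂ)
  have h2 := Complex.sq_norm ((z : ℂ) - axisPoint (axisProj z))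
  rw [Complex.normSq_apply] at h1 h2
  simp only [Complex.sub_re, Complex.sub_im, coe_re, coe_im, axisPoint_re, axisPoint_im,
    exp_axisProj] at h1 h2
  have := z.im_pos
  have := norm_coe_pos z
  rw [h2]
  field_simp
  linear_combination -h1

theorem axisProj_axisPoint (s : ℝ) : axisProj (axisPoint s) = s := by
  rw [axisProj, coe_axisPoint]
  simp

/-- Projection to the imaginary axis contracts, the more so the further away from the axis. -/
theorem sinh_axisProj_sub_le (z w : ℍ) : Real.sinh ((axisProj z - axisProj w) / 2) ≤
    √(z.im / ‖(z : ℂ)‖ * (w.im / ‖(w : ℂ)‖)) * Real.sinh (dist z w / 2) := by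
  have hz := norm_coe_pos z
  have hw := norm_coe_pos w
  have h1 : ‖(z : ℂ)‖ - ‖(w : ℂ)‖ ≤ dist (z : ℂ) w := by
    rw [Complex.dist_eq]; exact norm_sub_norm_le _ _
  set a := axisProj z
  set b := axisProj w
  have e : Real.sinh ((a - b) / 2) =
      (‖(z : ℂ)‖ - ‖(w : ℂ)‖) / (2 * √(‖(z : ℂ)‖ * ‖(w : ℂ)‖)) := by
    rw [← exp_axisProj, ← exp_axisProj, ← Real.exp_add, Real.sqrt_eq_rpow, ← Real.exp_mul,
      Real.sinh_eq]
    have e1 : Real.exp (axisProj z) = Real.exp ((a + b) * (1 / 2)) * Real.exp ((a - b) / 2) := by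
      rw [← Real.exp_add]; congr 1; ring
    have e2 : Real.exp (axisProj w) = Real.exp ((a + b) * (1 / 2)) * Real.exp (-((a - b) / 2)) := by
      rw [← Real.exp_add]; congr 1; ring
    rw [e1, e2]
    have := Real.exp_pos ((a + b) * (1 / 2))
    change _ = _ / (2 * Real.exp ((a + b) * (1 / 2)))
    field_simp
  rw [e, sinh_half_dist, div_mul_div_comm, Real.sqrt_div (by positivity)]
  have h2 : 0 < √(z.im * w.im) := Real.sqrt_pos.mpr (mul_pos z.im_pos w.im_pos)
  have h3 : 0 < √(‖(z : ℂ)‖ * ‖(w : ℂ)‖) := Real.sqrt_pos.mpr (by positivity)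
  rw [div_mul_div_comm, div_le_div_iff₀ (by positivity) (by positivity)]
  have := mul_le_mul_of_nonneg_left h1 (show 0 ≤ 2 * (√(z.im * w.im) *
    √(‖(z : ℂ)‖ * ‖(w : ℂ)‖)) by positivity)
  linarith

theorem axisProj_sub_le_dist (z w : ℍ) : axisProj z - axisProj w ≤ dist z w := by
  have h := sinh_axisProj_sub_le z w
  have h0 : 0 ≤ Real.sinh (dist z w / 2) := Real.sinh_nonneg_iff.mpr (by positivity)
  have hz : z.im / ‖(z : ℂ)‖ ≤ 1 := (div_le_one (norm_coe_pos z)).mpr (im_le_norm z)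
  have hw : w.im / ‖(w : ℂ)‖ ≤ 1 := (div_le_one (norm_coe_pos w)).mpr (im_le_norm w)
  have hw0 : 0 ≤ w.im / ‖(w : ℂ)‖ := div_nonneg w.im_pos.le (norm_nonneg _)
  have h1 : √(z.im / ‖(z : ℂ)‖ * (w.im / ‖(w : ℂ)‖)) ≤ 1 :=
    Real.sqrt_le_one.mpr (mul_le_one₀ hz hw0 hw)
  have h2 := h.trans (mul_le_of_le_one_left h0 h1)
  have h3 := Real.sinh_le_sinh.mp h2
  linarith

theorem abs_axisProj_sub_le_dist (z w : ℍ) : |axisProj z - axisProj w| ≤ dist z w := by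
  rw [abs_le]
  constructor
  · have := axisProj_sub_le_dist w z
    rw [dist_comm] at this
    linarith
  · exact axisProj_sub_le_dist z w

/-- By `cosh_dist_axisPoint_axisProj` the factor under the root in `sinh_axisProj_sub_le` is the
product of the inverse hyperbolic cosines of the distances to the axis, so the projection contracts
exponentially in the distance. -/
theorem axisProj_sub_le_of_le_cosh {z w : ℍ} {t : ℝ} (ht : 0 < t)
    (hz : t ≤ Real.cosh (dist z (axisPoint (axisProj z))))
    (hw : t ≤ Real.cosh (dist w (axisPoint (axisProj w)))) :
    axisProj z - axisProj w ≤ 2 * Real.sinh (dist z w / 2) / t := by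
  rw [cosh_dist_axisPoint_axisProj] at hz hw
  have h := sinh_axisProj_sub_le z w
  have h0 : 0 ≤ Real.sinh (dist z w / 2) := Real.sinh_nonneg_iff.mpr (by positivity)
  have key : ∀ u : ℍ, t ≤ ‖(u : ℂ)‖ / u.im → 0 ≤ u.im / ‖(u : ℂ)‖ ∧ u.im / ‖(u : ℂ)‖ ≤ 1 / t := by
    intro u hu
    refine ⟨div_nonneg u.im_pos.le (norm_nonneg _), ?_⟩
    rw [le_div_iff₀ u.im_pos] at hu
    rw [div_le_div_iff₀ (norm_coe_pos u) ht]
    linarith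
  have h1 : √(z.im / ‖(z : ℂ)‖ * (w.im / ‖(w : ℂ)‖)) ≤ 1 / t := by
    refine Real.sqrt_le_iff.mpr ⟨by positivity, ?_⟩
    rw [sq]
    exact mul_le_mul (key z hz).2 (key w hw).2 (key w hw).1 (by positivity)
  have h2 := h.trans (mul_le_mul_of_nonneg_right h1 h0)
  rcases le_total 0 (axisProj z - axisProj w) with h3 | h3
  · have h4 := Real.self_le_sinh_iff.mpr (show 0 ≤ (axisProj z - axisProj w) / 2 by linarith)
    have e : 2 * Real.sinh (dist z w / 2) / t = 2 * (1 / t * Real.sinh (dist z w / 2)) := by ring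
    rw [e]; linarith
  · exact h3.trans (by positivity)

theorem abs_axisProj_sub_le_of_le_cosh {z w : ℍ} {t : ℝ} (ht : 0 < t)
    (hz : t ≤ Real.cosh (dist z (axisPoint (axisProj z))))
    (hw : t ≤ Real.cosh (dist w (axisPoint (axisProj w)))) :
    |axisProj z - axisProj w| ≤ 2 * Real.sinh (dist z w / 2) / t := by
  rw [abs_le]
  constructor
  · have := axisProj_sub_le_of_le_cosh ht hw hz
    rw [dist_comm] at this
    linarith
  · exact axisProj_sub_le_of_le_cosh ht hz hw

/-- Position of the projection to the segment of the imaginary axis between the points at heights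
`exp s` and `exp t`. -/
noncomputable def segProj (s t : ℝ) (z : ℍ) : ℝ := max s (min t (axisProj z))

/-- Distance to the projection to a segment of the imaginary axis. -/
noncomputable def segDist (s t : ℝ) (z : ℍ) : ℝ := dist z (axisPoint (segProj s t z))

theorem abs_segProj_sub_le (s t : ℝ) (z w : ℍ) :
    |segProj s t z - segProj s t w| ≤ |axisProj z - axisProj w| :=
  (abs_max_sub_max_le_max _ _ _ _).trans <| by
    rw [sub_self, abs_zero]
    refine max_le (abs_nonneg _) ((abs_min_sub_min_le_max _ _ _ _).trans ?_)
    simp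

/-- One copy of the distance pays for moving the point, the other for moving its foot. That the foot
is the nearest point of the segment is not needed. -/
theorem segDist_le_add (s t : ℝ) (z w : ℍ) : segDist s t z ≤ segDist s t w + 2 * dist z w := by
  have h1 := abs_segProj_sub_le s t w z
  have h2 := abs_axisProj_sub_le_dist w z
  have h3 := dist_triangle4 z w (axisPoint (segProj s t w)) (axisPoint (segProj s t z))
  rw [dist_axisPoint] at h3
  rw [dist_comm] at h2
  unfold segDist
  linarith

theorem dist_le_segDist_add (s t : ℝ) (z w : ℍ) :
    dist z w ≤ segDist s t z + |segProj s t z - segProj s t w| + segDist s t w := by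
  have h3 := dist_triangle4 z (axisPoint (segProj s t z)) (axisPoint (segProj s t w)) w
  rw [dist_axisPoint, dist_comm (axisPoint (segProj s t w)) w] at h3
  exact h3

/-- If truncation to `[s, t]` separates the two projections, then the end point at which one is
truncated lies between them. -/
theorem abs_axisProj_sub_segProj_le {s t : ℝ} {z w : ℍ}
    (h : segProj s t z ≠ segProj s t w) :
    |axisProj z - segProj s t z| ≤ |axisProj z - axisProj w| := by
  unfold segProj at *
  rcases le_total (axisProj z) t with h1 | h1
  · rw [min_eq_right h1] at *
    rcases le_total s (axisProj z) with h2 | h2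
    · rw [max_eq_right h2, sub_self, abs_zero]; positivity
    · rw [max_eq_left h2] at *
      have h3 : s < axisProj w := by
        by_contra! h4
        exact h (by rw [max_eq_left ((min_le_right _ _).trans h4)])
      rw [abs_of_nonpos (by linarith), abs_of_nonpos (by linarith)]
      linarith
  · rw [min_eq_left h1] at *
    rcases le_total s t with h2 | h2
    · rw [max_eq_right h2] at *
      have h3 : axisProj w < t := by
        by_contra! h4
        exact h (by rw [min_eq_left h4, max_eq_right h2])
      rw [abs_of_nonneg (by linarith), abs_of_nonneg (by linarith)]
      linarith
    · exact absurd (by rw [max_eq_left h2, max_eq_left ((min_le_left _ _).trans h2)]) h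

/-- Either both feet coincide, or truncation moves each by at most `K`. In the second case, being `K
+ r` away from the foot on the segment forces distance `r` from the foot on the whole axis, and the
contraction estimate applies. -/
theorem abs_segProj_sub_le_of_le_segDist {s t K r u : ℝ} {z w : ℍ} (hK : dist z w ≤ K)
    (hr : 0 ≤ r) (hu : 0 < u) (hur : u ≤ Real.cosh r)
    (hz : K + r ≤ segDist s t z) (hw : K + r ≤ segDist s t w) :
    |segProj s t z - segProj s t w| ≤ 2 * Real.sinh (K / 2) / u := by
  have hK0 : 0 ≤ K := dist_nonneg.trans hK
  by_cases h : segProj s t z = segProj s t w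
  · rw [h, sub_self, abs_zero]
    have : 0 ≤ Real.sinh (K / 2) := Real.sinh_nonneg_iff.mpr (by positivity)
    positivity
  have key : ∀ {z w : ℍ}, dist z w ≤ K → segProj s t z ≠ segProj s t w → K + r ≤ segDist s t z →
      u ≤ Real.cosh (dist z (axisPoint (axisProj z))) := by
    intro z w hK h hz
    refine hur.trans (Real.cosh_le_cosh.mpr ?_)
    rw [abs_of_nonneg hr, abs_of_nonneg dist_nonneg]
    have h1 := abs_axisProj_sub_segProj_le h
    have h2 := abs_axisProj_sub_le_dist z w
    have h3 := dist_triangle z (axisPoint (axisProj z)) (axisPoint (segProj s t z))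
    rw [dist_axisPoint] at h3
    unfold segDist at hz
    linarith
  refine (abs_segProj_sub_le s t z w).trans ((abs_axisProj_sub_le_of_le_cosh hu (key hK h hz)
    (key (by rwa [dist_comm]) (Ne.symm h) hw)).trans ?_)
  have : Real.sinh (dist z w / 2) ≤ Real.sinh (K / 2) := Real.sinh_le_sinh.mpr (by linarith)
  gcongr

/-! ### Stability of quasi-geodesics -/

theorem exists_last_before {P : ℕ → Prop} (h0 : P 0) :
    ∀ {j : ℕ}, ¬ P j → ∃ i < j, P i ∧ ∀ k, i < k → k ≤ j → ¬ P k
  | 0, h => absurd h0 h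
  | j + 1, h => by
    by_cases hj : P j
    · refine ⟨j, j.lt_succ_self, hj, fun k h1 h2 => ?_⟩
      rwa [show k = j + 1 by omega]
    · obtain ⟨i, h1, h2, h3⟩ := exists_last_before h0 hj
      refine ⟨i, by omega, h2, fun k h4 h5 => ?_⟩
      rcases Nat.lt_or_ge j k with h6 | h6
      · rwa [show k = j + 1 by omega]
      · exact h3 k h4 h6

theorem exists_first_after {P : ℕ → Prop} {n j : ℕ} (hn : P n) (hjn : j ≤ n) (hj : ¬ P j) :
    ∃ i, j < i ∧ i ≤ n ∧ P i ∧ ∀ k, j ≤ k → k < i → ¬ P k := by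
  classical
  have hex : ∃ i, j ≤ i ∧ P i := ⟨n, hjn, hn⟩
  refine ⟨Nat.find hex, ?_, Nat.find_min' hex ⟨hjn, hn⟩, (Nat.find_spec hex).2, fun k h1 h2 h3 =>
    Nat.find_min hex h2 ⟨h1, h3⟩⟩
  rcases (Nat.find_spec hex).1.lt_or_eq with h | h
  · exact h
  · exact absurd (h ▸ (Nat.find_spec hex).2) hj

theorem dist_le_mul_of_dist_succ_le {q : ℕ → ℍ} {K : ℝ} {n : ℕ}
    (hq : ∀ i < n, dist (q i) (q (i + 1)) ≤ K) {i j : ℕ} (hij : i ≤ j) (hj : j ≤ n) :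
    dist (q i) (q j) ≤ K * ((j : ℝ) - i) := by
  induction j, hij using Nat.le_induction with
  | base => simp
  | succ k hk ih =>
    have h1 := ih (by omega)
    have h2 := hq k (by omega)
    have h3 := dist_triangle (q i) (q k) (q (k + 1))
    push_cast
    linarith

/-- Stability of quasi-geodesics between two points of the imaginary axis. -/
theorem exists_segDist_le {A B K : ℝ} (hA : 0 < A) (hB : 0 ≤ B) (hK : 0 ≤ K) :
    ∃ C, 0 ≤ C ∧ ∀ (n : ℕ) (q : ℕ → ℍ) (s t : ℝ), s ≤ t → q 0 = axisPoint s → q n = axisPoint t →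
      (∀ i < n, dist (q i) (q (i + 1)) ≤ K) →
      (∀ i j, i ≤ j → j ≤ n → ((j : ℝ) - i) / A - B ≤ dist (q i) (q j)) →
      ∀ j ≤ n, segDist s t (q j) ≤ C := by
  -- Beyond distance `D = K + u` from the segment, one step moves the foot by at most `1 / (2 * A)`:
  -- half the speed that the lower quasi-isometry bound demands.
  set u := 2 * Real.sinh (K / 2) * (2 * A) + 1 with hu
  have hs : 0 ≤ Real.sinh (K / 2) := Real.sinh_nonneg_iff.mpr (by positivity)
  have hu0 : 0 < u := by positivity
  have hur : u ≤ Real.cosh u := (Real.self_le_sinh_iff.mpr hu0.le).trans (Real.sinh_lt_cosh u).le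
  have hε : 2 * Real.sinh (K / 2) / u ≤ 1 / (2 * A) := by
    rw [div_le_div_iff₀ hu0 (by positivity)]; linarith
  set D := K + u with hD
  have hD0 : 0 ≤ D := by positivity
  -- Bound for the length of an excursion beyond distance `D`, obtained by solving `L / A - B ≤ 2 *
  -- (D + 2 * K) + L / (2 * A)` for `L`.
  set N := 2 * A * (2 * (D + 2 * K) + B) with hN
  have hN0 : 0 ≤ N := by positivity
  refine ⟨D + 2 * K + 2 * (K * N), by positivity, fun n q s t hst h0 hn hq1 hq2 j hj => ?_⟩
  by_cases hjD : segDist s t (q j) ≤ D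
  · have : 0 ≤ K * N := by positivity
    linarith
  have hP0 : segDist s t (q 0) ≤ D := by
    rw [h0, segDist, segProj, axisProj_axisPoint, min_eq_right hst, max_self, dist_self]
    exact hD0
  have hPn : segDist s t (q n) ≤ D := by
    rw [hn, segDist, segProj, axisProj_axisPoint, min_self, max_eq_right hst, dist_self]
    exact hD0
  -- The excursion containing `j` occupies the indices `a + 1, …, b - 1`; both of its ends are one
  -- step away from the `D`-neighbourhood.
  obtain ⟨a, ha1, ha2, ha3⟩ :=
    exists_last_before (P := fun i => segDist s t (q i) ≤ D) hP0 hjD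
  obtain ⟨b, hb1, hb2, hb3, hb4⟩ :=
    exists_first_after (P := fun i => segDist s t (q i) ≤ D) hPn hj hjD
  obtain ⟨c, rfl⟩ : ∃ c, b = c + 1 := ⟨b - 1, by omega⟩
  have hout : ∀ k, a + 1 ≤ k → k ≤ c → D < segDist s t (q k) := by
    intro k h1 h2
    rcases le_total k j with h | h
    · exact not_le.mp (ha3 k (by omega) h)
    · exact not_le.mp (hb4 k h (by omega))
  have hproj : ∀ k, a + 1 ≤ k → k ≤ c →
      |segProj s t (q (a + 1)) - segProj s t (q k)| ≤ 1 / (2 * A) * ((k : ℝ) - (a + 1 : ℕ)) := by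
    intro k hk
    induction k, hk using Nat.le_induction with
    | base => simp
    | succ k hk ih =>
      intro hkc
      have h1 := ih (by omega)
      have h2 := (abs_segProj_sub_le_of_le_segDist (hq1 k (by omega)) hu0.le hu0 hur
        (hout k hk (by omega)).le (hout (k + 1) (by omega) hkc).le).trans hε
      have h3 := abs_sub_le (segProj s t (q (a + 1))) (segProj s t (q k)) (segProj s t (q (k + 1)))
      push_cast at *
      linarith
  have hpa : segDist s t (q (a + 1)) ≤ D + 2 * K := by
    have h1 := segDist_le_add s t (q (a + 1)) (q a)
    have h2 := hq1 a (by omega)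
    rw [dist_comm] at h1
    linarith
  have hpc : segDist s t (q c) ≤ D + 2 * K := by
    have h1 := segDist_le_add s t (q c) (q (c + 1))
    have h2 := hq1 c (by omega)
    linarith
  have hlen : (c : ℝ) - (a + 1 : ℕ) ≤ N := by
    have h1 := hq2 (a + 1) c (by omega) (by omega)
    have h2 := dist_le_segDist_add s t (q (a + 1)) (q c)
    have h3 := hproj c (by omega) le_rfl
    set L := (c : ℝ) - (a + 1 : ℕ)
    have h4 : L / A ≤ 2 * (D + 2 * K) + B + 1 / (2 * A) * L := by linarith
    have h5 : L / A = 2 * (1 / (2 * A) * L) := by field_simp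
    have h6 : 1 / (2 * A) * L ≤ 2 * (D + 2 * K) + B := by linarith
    rw [one_div, inv_mul_le_iff₀ (by positivity)] at h6
    exact h6
  have hd : dist (q (a + 1)) (q j) ≤ K * N := by
    refine (dist_le_mul_of_dist_succ_le hq1 (by omega) hj).trans ?_
    have : (j : ℝ) ≤ c := by exact_mod_cast (by omega : j ≤ c)
    gcongr
    linarith
  have := segDist_le_add s t (q j) (q (a + 1))
  rw [dist_comm] at this
  linarith

/-! ### Gromov products -/

/-- Twice the Gromov product of `z` and `w` seen from `x`. -/
noncomputable def defect (x z w : ℍ) : ℝ := dist x z + dist x w - dist z w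

theorem segProj_mem {s t : ℝ} (hst : s ≤ t) (z : ℍ) : segProj s t z ∈ Set.Icc s t :=
  ⟨le_max_left _ _, max_le hst (min_le_left _ _)⟩

theorem defect_le_of_segDist {s t : ℝ} (hst : s ≤ t) (x : ℍ) :
    defect x (axisPoint s) (axisPoint t) ≤ 2 * segDist s t x := by
  have h := segProj_mem hst x
  have h1 := dist_triangle x (axisPoint (segProj s t x)) (axisPoint s)
  have h2 := dist_triangle x (axisPoint (segProj s t x)) (axisPoint t)
  rw [dist_axisPoint, abs_of_nonneg (by linarith [h.1])] at h1
  rw [dist_axisPoint, abs_of_nonpos (by linarith [h.2])] at h2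
  rw [defect, dist_axisPoint, abs_of_nonpos (by linarith)]
  unfold segDist
  linarith

theorem defect_smul (g : Matrix.SpecialLinearGroup (Fin 2) ℝ) (x z w : ℍ) :
    defect (g • x) (g • z) (g • w) = defect x z w := by
  simp [defect]

theorem defect_le_add_left (x y z w : ℍ) : defect x z w ≤ defect y z w + 2 * dist x y := by
  have h1 := dist_triangle x y z
  have h2 := dist_triangle x y w
  unfold defect
  linarith

theorem defect_le_add_right (x z w v : ℍ) : defect x z w ≤ defect x z v + 2 * dist w v := by
  have h1 := dist_triangle x v w
  have h2 := dist_triangle z w v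
  rw [dist_comm v w] at h1
  unfold defect
  linarith

theorem exists_defect_le {A B K : ℝ} (hA : 0 < A) (hB : 0 ≤ B) (hK : 0 ≤ K) :
    ∃ C, 0 ≤ C ∧ ∀ (n : ℕ) (q : ℕ → ℍ), (∀ i < n, dist (q i) (q (i + 1)) ≤ K) →
      (∀ i j, i ≤ j → j ≤ n → ((j : ℝ) - i) / A - B ≤ dist (q i) (q j)) →
      ∀ j ≤ n, defect (q j) (q 0) (q n) ≤ C := by
  obtain ⟨C, hC0, hC⟩ := exists_segDist_le hA hB hK
  refine ⟨2 * C, by positivity, fun n q h1 h2 j hj => ?_⟩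
  obtain ⟨g, s, t, hst, hs, ht⟩ := exists_smul_eq_axisPoint (q 0) (q n)
  have h := hC n (fun i => g • q i) s t hst hs ht (fun i hi => by simpa using h1 i hi)
    (fun i j hij hj => by simpa using h2 i j hij hj) j hj
  rw [← defect_smul g, hs, ht]
  exact (defect_le_of_segDist hst _).trans (by linarith)

/-- Up to bounded factors the exponential of the Gromov product of `z` and `w` seen from `x`. -/
noncomputable def expGromov (x z w : ℍ) : ℝ :=
  dist (x : ℂ) (starRingEnd ℂ z) * dist (x : ℂ) (starRingEnd ℂ w) /
    (x.im * dist (z : ℂ) (starRingEnd ℂ w))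

theorem dist_conj_eq (z w : ℍ) : dist (z : ℂ) (starRingEnd ℂ w) =
    2 * √z.im * √w.im * Real.cosh (dist z w / 2) := by
  have h1 : 0 < √z.im := Real.sqrt_pos.mpr z.im_pos
  have h2 : 0 < √w.im := Real.sqrt_pos.mpr w.im_pos
  rw [cosh_half_dist, Real.sqrt_mul z.im_pos.le]
  field_simp

theorem dist_conj_pos (z w : ℍ) : 0 < dist (z : ℂ) (starRingEnd ℂ w) := by
  have h1 : 0 < √z.im := Real.sqrt_pos.mpr z.im_pos
  have h2 : 0 < √w.im := Real.sqrt_pos.mpr w.im_pos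
  have := Real.cosh_pos (dist z w / 2)
  rw [dist_conj_eq]
  positivity

theorem dist_conj_comm (z w : ℍ) :
    dist (z : ℂ) (starRingEnd ℂ w) = dist (w : ℂ) (starRingEnd ℂ z) := by
  rw [dist_conj_eq, dist_conj_eq, dist_comm]; ring

/-- The conjugate distances are hyperbolic cosines of half distances, up to heights that cancel.
Unlike `defect`, the Euclidean form can be studied directly as `z` and `w` approach the boundary. -/
theorem expGromov_eq (x z w : ℍ) : expGromov x z w = 2 * Real.cosh (dist x z / 2) *
    Real.cosh (dist x w / 2) / Real.cosh (dist z w / 2) := by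
  have h0 : 0 < √x.im := Real.sqrt_pos.mpr x.im_pos
  have h1 : 0 < √z.im := Real.sqrt_pos.mpr z.im_pos
  have h2 : 0 < √w.im := Real.sqrt_pos.mpr w.im_pos
  have h3 := Real.cosh_pos (dist z w / 2)
  have h4 := Real.mul_self_sqrt x.im_pos.le
  rw [expGromov, dist_conj_eq, dist_conj_eq, dist_conj_eq]
  have hx := x.im_pos
  field_simp
  linear_combination h4

theorem exp_le_two_mul_cosh (t : ℝ) : Real.exp t ≤ 2 * Real.cosh t := by
  rw [Real.cosh_eq]
  have := Real.exp_pos (-t)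
  linarith

theorem cosh_le_exp {t : ℝ} (ht : 0 ≤ t) : Real.cosh t ≤ Real.exp t := by
  rw [Real.cosh_eq]
  have : Real.exp (-t) ≤ Real.exp t := Real.exp_le_exp.mpr (by linarith)
  linarith

theorem exp_defect_eq (x z w : ℍ) : Real.exp (defect x z w / 2) =
    Real.exp (dist x z / 2) * Real.exp (dist x w / 2) / Real.exp (dist z w / 2) := by
  rw [← Real.exp_add, ← Real.exp_sub, defect]
  congr 1
  ring

theorem expGromov_le (x z w : ℍ) : expGromov x z w ≤ 4 * Real.exp (defect x z w / 2) := by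
  rw [expGromov_eq, exp_defect_eq, ← mul_div_assoc,
    div_le_div_iff₀ (Real.cosh_pos _) (Real.exp_pos _)]
  have h1 := cosh_le_exp (show 0 ≤ dist x z / 2 by positivity)
  have h2 := cosh_le_exp (show 0 ≤ dist x w / 2 by positivity)
  have h3 := exp_le_two_mul_cosh (dist z w / 2)
  have h4 := Real.cosh_pos (dist x z / 2)
  have h5 := Real.cosh_pos (dist x w / 2)
  calc 2 * Real.cosh (dist x z / 2) * Real.cosh (dist x w / 2) * Real.exp (dist z w / 2)
      ≤ 2 * Real.exp (dist x z / 2) * Real.exp (dist x w / 2) *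
        (2 * Real.cosh (dist z w / 2)) := by gcongr
    _ = _ := by ring

theorem exp_defect_le (x z w : ℍ) : Real.exp (defect x z w / 2) ≤ 2 * expGromov x z w := by
  rw [expGromov_eq, exp_defect_eq, ← mul_div_assoc,
    div_le_div_iff₀ (Real.exp_pos _) (Real.cosh_pos _)]
  have h1 := exp_le_two_mul_cosh (dist x z / 2)
  have h2 := exp_le_two_mul_cosh (dist x w / 2)
  have h3 := cosh_le_exp (show 0 ≤ dist z w / 2 by positivity)
  have h4 := Real.cosh_pos (dist z w / 2)
  have h5 := Real.cosh_pos (dist x z / 2)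
  calc Real.exp (dist x z / 2) * Real.exp (dist x w / 2) * Real.cosh (dist z w / 2)
      ≤ (2 * Real.cosh (dist x z / 2)) * (2 * Real.cosh (dist x w / 2)) *
        Real.exp (dist z w / 2) := by gcongr
    _ = _ := by ring

theorem defect_le_of_expGromov_le {x z w : ℍ} {M : ℝ} (h : expGromov x z w ≤ M) :
    defect x z w ≤ 2 * Real.log (2 * M) := by
  have h1 := (exp_defect_le x z w).trans (mul_le_mul_of_nonneg_left h two_pos.le)
  have h2 : 0 < 2 * M := (Real.exp_pos _).trans_le h1
  have := (Real.le_log_iff_exp_le h2).mpr h1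
  linarith

theorem norm_le_dist_conj_axisPoint (x : ℍ) (s : ℝ) :
    ‖(x : ℂ)‖ ≤ dist (x : ℂ) (starRingEnd ℂ (axisPoint s)) ∧
    Real.exp s ≤ dist (x : ℂ) (starRingEnd ℂ (axisPoint s)) := by
  have hx := x.im_pos
  have hs := Real.exp_pos s
  rw [Complex.dist_eq]
  constructor
  · rw [Complex.norm_def, Complex.norm_def]
    refine Real.sqrt_le_sqrt ?_
    rw [Complex.normSq_apply, Complex.normSq_apply]
    simp only [Complex.sub_re, Complex.sub_im, Complex.conj_re, Complex.conj_im, coe_re, coe_im,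
      axisPoint_re, axisPoint_im]
    nlinarith
  · refine le_trans ?_ (Complex.abs_im_le_norm _)
    rw [Complex.sub_im, Complex.conj_im, coe_im, coe_im, axisPoint_im]
    exact le_trans (by linarith) (le_abs_self _)

theorem dist_conj_axisPoint (s t : ℝ) :
    dist (axisPoint s : ℂ) (starRingEnd ℂ (axisPoint t)) = Real.exp s + Real.exp t := by
  have : (axisPoint s : ℂ) - starRingEnd ℂ (axisPoint t) =
      ((Real.exp s + Real.exp t : ℝ) : ℂ) * Complex.I := by
    rw [coe_axisPoint, coe_axisPoint, map_mul, Complex.conj_ofReal, Complex.conj_I]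
    push_cast
    ring
  rw [Complex.dist_eq, this, norm_mul, Complex.norm_I, mul_one, Complex.norm_real,
    Real.norm_of_nonneg (by positivity)]

/-- Each of the two numerator factors dominates `‖x‖` and the height of its end point. Choosing
among these bounds gives that `x` is close to the axis (`e1`) and that its foot does not overshoot
either end by much (`e2`, `e3`). -/
theorem segDist_le_of_expGromov_le {s t p : ℝ} (hst : s ≤ t) {x : ℍ}
    (hp : expGromov x (axisPoint s) (axisPoint t) ≤ p) : segDist s t x ≤ 2 * Real.log (4 * p) := by
  obtain ⟨h1, h2⟩ := norm_le_dist_conj_axisPoint x s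
  obtain ⟨h3, h4⟩ := norm_le_dist_conj_axisPoint x t
  have hx := x.im_pos
  have hn := norm_coe_pos x
  have hxn := im_le_norm x
  have hs := Real.exp_pos s
  have ht := Real.exp_pos t
  have hst' : Real.exp s ≤ Real.exp t := Real.exp_le_exp.mpr hst
  rw [expGromov, dist_conj_axisPoint, div_le_iff₀ (by positivity)] at hp
  set a := dist (x : ℂ) (starRingEnd ℂ (axisPoint s))
  set b := dist (x : ℂ) (starRingEnd ℂ (axisPoint t))
  have hp0 : 0 < p := by
    have : 0 < p * (x.im * (Real.exp s + Real.exp t)) := 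
      (mul_pos (hs.trans_le h2) (ht.trans_le h4)).trans_le hp
    exact pos_of_mul_pos_left this (by positivity)
  have hp' : a * b ≤ p * (x.im * (2 * Real.exp t)) :=
    hp.trans (by gcongr; linarith)
  have e1 : ‖(x : ℂ)‖ ≤ 2 * p * x.im := by
    have : ‖(x : ℂ)‖ * Real.exp t ≤ (2 * p * x.im) * Real.exp t :=
      calc _ ≤ a * b := by gcongr
        _ ≤ _ := hp'
        _ = _ := by ring
    exact le_of_mul_le_mul_right this ht
  have e2 : ‖(x : ℂ)‖ ≤ 2 * p * Real.exp t := by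
    have : ‖(x : ℂ)‖ * ‖(x : ℂ)‖ ≤ (2 * p * Real.exp t) * ‖(x : ℂ)‖ :=
      calc _ ≤ a * b := by gcongr
        _ ≤ _ := hp'
        _ ≤ p * (‖(x : ℂ)‖ * (2 * Real.exp t)) := by gcongr
        _ = _ := by ring
    exact le_of_mul_le_mul_right this hn
  have e3 : Real.exp s ≤ 2 * p * ‖(x : ℂ)‖ := by
    have : Real.exp s * Real.exp t ≤ (2 * p * ‖(x : ℂ)‖) * Real.exp t :=
      calc _ ≤ a * b := by gcongr
        _ ≤ _ := hp'
        _ ≤ p * (‖(x : ℂ)‖ * (2 * Real.exp t)) := by gcongr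
        _ = _ := by ring
    exact le_of_mul_le_mul_right this ht
  have h2p : 1 ≤ 2 * p := by
    by_contra! h
    nlinarith
  have f1 : dist x (axisPoint (axisProj x)) ≤ Real.log (4 * p) := by
    rw [Real.le_log_iff_exp_le (by positivity)]
    have := exp_le_two_mul_cosh (dist x (axisPoint (axisProj x)))
    rw [cosh_dist_axisPoint_axisProj] at this
    have h5 : ‖(x : ℂ)‖ / x.im ≤ 2 * p := (div_le_iff₀ hx).mpr e1
    linarith
  have hl0 : 0 ≤ Real.log (2 * p) := Real.log_nonneg h2p
  have hl : Real.log (2 * p) ≤ Real.log (4 * p) := Real.log_le_log (by linarith) (by linarith)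
  have g2 : axisProj x ≤ Real.log (2 * p) + t := by
    have := Real.log_le_log hn e2
    rwa [Real.log_mul (by positivity) (by positivity), Real.log_exp] at this
  have g3 : s ≤ Real.log (2 * p) + axisProj x := by
    have := Real.log_le_log hs e3
    rwa [Real.log_mul (by positivity) (by positivity), Real.log_exp] at this
  have f2 : |axisProj x - segProj s t x| ≤ Real.log (2 * p) := by
    unfold segProj
    rw [abs_le]
    rcases le_total (axisProj x) t with h5 | h5
    · rw [min_eq_right h5]
      rcases le_total s (axisProj x) with h6 | h6
      · rw [max_eq_right h6]; constructor <;> linarith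
      · rw [max_eq_left h6]; constructor <;> linarith
    · rw [min_eq_left h5, max_eq_right hst]; constructor <;> linarith
  have := dist_triangle x (axisPoint (axisProj x)) (axisPoint (segProj s t x))
  rw [dist_axisPoint] at this
  unfold segDist
  linarith

/-! ### Quasi-isometries and Gromov products -/

theorem QuasiIsometryWith.comp_smul {A B : ℝ} {f : ℍ → ℍ} (hf : QuasiIsometryWith A B f)
    (g h : Matrix.SpecialLinearGroup (Fin 2) ℝ) : QuasiIsometryWith A B fun z => g • f (h • z) :=
  fun x y => by simpa using hf (h • x) (h • y)

/-- Stability of quasi-geodesics: quasi-isometries quasi-preserve Gromov products. -/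
theorem exists_defect_map_le {A B : ℝ} (hA : 0 < A) (hB : 0 ≤ B) (M : ℝ) :
    ∃ C, ∀ f : ℍ → ℍ, QuasiIsometryWith A B f → ∀ x z w, defect x z w ≤ M →
      defect (f x) (f z) (f w) ≤ C := by
  obtain ⟨C, -, hC⟩ := exists_defect_le hA hB (K := A + B) (by positivity)
  set F := 2 * Real.log (4 * (4 * Real.exp (M / 2)))
  -- A bounded Gromov product puts `x` within `F` of the geodesic segment. The error terms come from
  -- replacing `x` by a sample point within `F + 1`, and the end point by the last sample point,
  -- within `1`.
  refine ⟨C + 2 * (A * (F + 1) + B) + 2 * (A + B), fun f hf x z w hM => ?_⟩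
  obtain ⟨g, s, t, hst, hs, ht⟩ := exists_smul_eq_axisPoint z w
  have hf' : QuasiIsometryWith A B fun u => f (g⁻¹ • u) := by
    simpa using hf.comp_smul 1 g⁻¹
  set f' : ℍ → ℍ := fun u => f (g⁻¹ • u) with hf'_def
  have hfx : ∀ u, f u = f' (g • u) := fun u => by simp [hf'_def]
  rw [hfx, hfx z, hfx w, hs, ht]
  rw [← defect_smul g, hs, ht] at hM
  set y := g • x
  have hF : segDist s t y ≤ F := segDist_le_of_expGromov_le hst <|
    (expGromov_le _ _ _).trans (by gcongr)
  obtain ⟨hm1, hm2⟩ := segProj_mem hst y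
  set σ := segProj s t y with hσ
  -- The segment is sampled at unit steps starting from `s`, so that its image is a discrete
  -- quasi-geodesic with step at most `A + B`.
  set n := ⌊t - s⌋₊
  set j := ⌊σ - s⌋₊
  have hjn : j ≤ n := Nat.floor_le_floor (by linarith)
  have hj1 := Nat.floor_le (show 0 ≤ σ - s by linarith)
  have hj2 := Nat.lt_floor_add_one (σ - s)
  have hn1 := Nat.floor_le (show 0 ≤ t - s by linarith)
  have hn2 := Nat.lt_floor_add_one (t - s)
  have h := hC n (fun i => f' (axisPoint (s + i))) (fun i _ => by
      have := (hf' (axisPoint (s + i)) (axisPoint (s + (i + 1 : ℕ)))).2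
      rw [dist_axisPoint] at this
      have e : |s + (i : ℝ) - (s + (i + 1 : ℕ))| = 1 := by
        push_cast; rw [show s + (i : ℝ) - (s + (i + 1)) = -1 by ring]; simp
      rwa [e, mul_one] at this) (fun i k hik _ => by
      have := (hf' (axisPoint (s + i)) (axisPoint (s + k))).1
      rw [dist_axisPoint] at this
      have hik' : (i : ℝ) ≤ k := by exact_mod_cast hik
      rw [abs_of_nonpos (by linarith)] at this
      refine le_trans (le_of_eq ?_) this
      rw [div_eq_inv_mul]; ring) j hjn
  simp only [Nat.cast_zero, add_zero] at h
  have d1 : dist (f' y) (f' (axisPoint (s + j))) ≤ A * (F + 1) + B := by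
    refine (hf' _ _).2.trans ?_
    gcongr
    refine (dist_triangle y (axisPoint σ) _).trans (add_le_add hF ?_)
    rw [dist_axisPoint, abs_of_nonneg (by linarith)]
    linarith
  have d2 : dist (f' (axisPoint t)) (f' (axisPoint (s + n))) ≤ A + B := by
    refine (hf' _ _).2.trans ?_
    gcongr
    refine mul_le_of_le_one_right hA.le ?_
    rw [dist_axisPoint, abs_of_nonneg (by linarith)]
    linarith
  have g1 := defect_le_add_left (f' y) (f' (axisPoint (s + j))) (f' (axisPoint s)) (f' (axisPoint t))
  have g2 := defect_le_add_right (f' (axisPoint (s + j))) (f' (axisPoint s)) (f' (axisPoint t))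
    (f' (axisPoint (s + n)))
  linarith

/-! ### The ideal boundary -/

theorem injective_onePointMap_ofReal :
    Function.Injective (OnePoint.map Complex.ofReal : OnePoint ℝ → OnePoint ℂ) :=
  Option.map_injective Complex.ofReal_injective

theorem continuous_onePointMap_ofReal :
    Continuous (OnePoint.map Complex.ofReal : OnePoint ℝ → OnePoint ℂ) := by
  refine OnePoint.continuous_map Complex.continuous_ofReal ?_
  simpa only [coclosedCompact_eq_cocompact] using
    Complex.isometry_ofReal.isClosedEmbedding.tendsto_cocompact

/-- The trace on the upper half plane of the neighbourhoods of an ideal boundary point. -/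
noncomputable def idealNhds (ξ : OnePoint ℝ) : Filter ℍ :=
  comap (fun z : ℍ => ((z : ℂ) : OnePoint ℂ)) (𝓝 (OnePoint.map Complex.ofReal ξ))

theorem idealNhds_coe (x : ℝ) : idealNhds x = comap ((↑) : ℍ → ℂ) (𝓝 (x : ℂ)) := by
  rw [idealNhds, OnePoint.map_some, ← OnePoint.comap_coe_nhds (x : ℂ), comap_comap]
  rfl

theorem idealNhds_infty :
    idealNhds (OnePoint.infty) = comap (fun z : ℍ => ‖(z : ℂ)‖) atTop := by
  rw [idealNhds, OnePoint.map_infty,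
    show (fun z : ℍ => ((z : ℂ) : OnePoint ℂ)) = ((↑) : ℂ → OnePoint ℂ) ∘ ((↑) : ℍ → ℂ) from rfl,
    ← comap_comap, OnePoint.comap_coe_nhds_infty, coclosedCompact_eq_cocompact,
    ← Metric.cobounded_eq_cocompact, ← comap_norm_atTop, comap_comap]
  rfl

theorem tendsto_idealNhds_coe {α : Type*} {l : Filter α} {f : α → ℍ} {x : ℝ} :
    Tendsto f l (idealNhds x) ↔ Tendsto (fun a => (f a : ℂ)) l (𝓝 (x : ℂ)) := by
  rw [idealNhds_coe, tendsto_comap_iff]; rfl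

theorem tendsto_idealNhds_infty {α : Type*} {l : Filter α} {f : α → ℍ} :
    Tendsto f l (idealNhds (OnePoint.infty)) ↔ Tendsto (fun a => ‖(f a : ℂ)‖) l atTop := by
  rw [idealNhds_infty, tendsto_comap_iff]; rfl

theorem tendsto_coe_idealNhds (x : ℝ) :
    Tendsto ((↑) : ℍ → ℂ) (idealNhds x) (𝓝 (x : ℂ)) :=
  tendsto_idealNhds_coe.mp tendsto_id

theorem tendsto_norm_idealNhds_infty :
    Tendsto (fun z : ℍ => ‖(z : ℂ)‖) (idealNhds (OnePoint.infty)) atTop :=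
  tendsto_idealNhds_infty.mp tendsto_id

theorem tendsto_axisPoint_atTop :
    Tendsto axisPoint atTop (idealNhds (OnePoint.infty)) := by
  rw [tendsto_idealNhds_infty]
  refine Real.tendsto_exp_atTop.congr fun s => ?_
  rw [← exp_axisProj, axisProj_axisPoint]

theorem tendsto_toSL2R_smul (a : ℍ) (x : ℝ) :
    Tendsto (fun z => a.toSL2R • z) (idealNhds x) (idealNhds ((a.im * x + a.re : ℝ))) := by
  rw [tendsto_idealNhds_coe]
  simp only [coe_toSL2R_smul]
  push_cast
  exact ((tendsto_coe_idealNhds x).const_mul _).add_const _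

theorem tendsto_toSL2R_smul_infty (a : ℍ) :
    Tendsto (fun z => a.toSL2R • z) (idealNhds (OnePoint.infty)) (idealNhds (OnePoint.infty)) := by
  rw [tendsto_idealNhds_infty]
  simp only [coe_toSL2R_smul]
  have h : Tendsto (fun z : ℍ => a.im * ‖(z : ℂ)‖ + -‖(a.re : ℂ)‖) (idealNhds (OnePoint.infty))
      atTop := tendsto_atTop_add_const_right _ _
    (tendsto_norm_idealNhds_infty.const_mul_atTop a.im_pos)
  refine tendsto_atTop_mono (fun z => ?_) h
  have := norm_sub_norm_le ((a.im : ℂ) * z) (-(a.re : ℂ))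
  rw [sub_neg_eq_add, norm_mul, norm_neg, Complex.norm_real a.im,
    Real.norm_of_nonneg a.im_pos.le] at this
  linarith

theorem tendsto_inversion_smul_zero :
    Tendsto (fun z => inversion • z) (idealNhds (0 : ℝ)) (idealNhds (OnePoint.infty)) := by
  rw [tendsto_idealNhds_infty]
  simp only [coe_inversion_smul, norm_div, norm_neg, norm_one, one_div]
  refine Tendsto.inv_tendsto_nhdsGT_zero (tendsto_nhdsWithin_iff.mpr
    ⟨?_, Eventually.of_forall fun z => norm_coe_pos z⟩)
  simpa using (tendsto_coe_idealNhds 0).norm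

theorem tendsto_inversion_smul_infty :
    Tendsto (fun z => inversion • z) (idealNhds (OnePoint.infty)) (idealNhds (0 : ℝ)) := by
  rw [tendsto_idealNhds_coe, Complex.ofReal_zero, tendsto_zero_iff_norm_tendsto_zero]
  simp only [coe_inversion_smul, norm_div, norm_neg, norm_one, one_div]
  exact tendsto_norm_idealNhds_infty.inv_tendsto_atTop

instance idealNhds_neBot (ξ : OnePoint ℝ) : (idealNhds ξ).NeBot := by
  have h1 : (idealNhds (OnePoint.infty)).NeBot := tendsto_axisPoint_atTop.neBot
  have h2 : (idealNhds (0 : ℝ)).NeBot := tendsto_inversion_smul_infty.neBot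
  induction ξ using OnePoint.rec with
  | infty => exact h1
  | coe x =>
    have h := tendsto_toSL2R_smul (⟨⟨x, 1⟩, one_pos⟩ : ℍ) 0
    rw [mul_zero, zero_add] at h
    exact h.neBot

theorem idealNhds_tendsto_unique {α : Type*} {l : Filter α} [l.NeBot] {f : α → ℍ}
    {ξ η : OnePoint ℝ} (h1 : Tendsto f l (idealNhds ξ)) (h2 : Tendsto f l (idealNhds η)) :
    ξ = η :=
  injective_onePointMap_ofReal
    (tendsto_nhds_unique (tendsto_comap_iff.mp h1) (tendsto_comap_iff.mp h2))

theorem continuous_coe_onePoint : Continuous fun z : ℍ => ((z : ℂ) : OnePoint ℂ) :=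
  OnePoint.continuous_coe.comp continuous_coe

theorem idealNhds_le_cocompact (ξ : OnePoint ℝ) : idealNhds ξ ≤ cocompact ℍ := by
  refine hasBasis_cocompact.ge_iff.mpr fun K hK => ?_
  have hc := (hK.image continuous_coe_onePoint).isClosed
  refine ⟨_, hc.isOpen_compl.mem_nhds ?_, fun z hz hzK => hz ⟨z, hzK, rfl⟩⟩
  rintro ⟨z, -, hz⟩
  induction ξ using OnePoint.rec with
  | infty => exact OnePoint.coe_ne_infty _ hz
  | coe x =>
    have := congrArg Complex.im (OnePoint.coe_injective hz)
    simp at this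
    exact z.im_pos.ne' this

/-- The open lower half plane is disjoint from the image of `ℍ`, and a point of `ℍ` has a compact
neighbourhood, which the filter leaves. -/
theorem exists_eq_of_clusterPt {l : Filter ℍ} (hl : l ≤ cocompact ℍ) {η : OnePoint ℂ}
    (h : ClusterPt η (map (fun z : ℍ => ((z : ℂ) : OnePoint ℂ)) l)) :
    ∃ ξ : OnePoint ℝ, η = OnePoint.map Complex.ofReal ξ := by
  induction η using OnePoint.rec with
  | infty => exact ⟨OnePoint.infty, rfl⟩
  | coe w =>
    rcases lt_trichotomy w.im 0 with hw | hw | hw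
    · exfalso
      have h1 : {u : ℂ | u.im < 0} ∈ 𝓝 w :=
        (isOpen_lt Complex.continuous_im continuous_const).mem_nhds hw
      have h2 : ((↑) : ℂ → OnePoint ℂ) '' {u : ℂ | u.im < 0} ∈ 𝓝 (w : OnePoint ℂ) := by
        rw [OnePoint.nhds_coe_eq]; exact image_mem_map h1
      obtain ⟨_, ⟨u, hu, rfl⟩, ⟨z, hz⟩⟩ := clusterPt_iff_nonempty.mp h h2 (range_mem_map)
      have hz' : (z : ℂ) = u := OnePoint.coe_injective hz
      rw [Set.mem_ofPred_eq, ← hz'] at hu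
      exact absurd z.im_pos (not_lt.mpr hu.le)
    · refine ⟨(w.re : ℝ), ?_⟩
      rw [OnePoint.map_some]
      congr 1
      apply Complex.ext <;> simp [hw]
    · exfalso
      have h1 : Disjoint (𝓝 (⟨w, hw⟩ : ℍ)) l := (disjoint_nhds_cocompact _).mono_right hl
      have h2 : comap (fun z : ℍ => ((z : ℂ) : OnePoint ℂ)) (𝓝 (w : OnePoint ℂ)) =
          𝓝 (⟨w, hw⟩ : ℍ) :=
        ((OnePoint.isOpenEmbedding_coe.comp
          UpperHalfPlane.isOpenEmbedding_coe).toIsEmbedding.nhds_eq_comap (⟨w, hw⟩ : ℍ)).symm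
      rw [← h2, disjoint_iff] at h1
      have h3 : (map (fun z : ℍ => ((z : ℂ) : OnePoint ℂ))
          (comap (fun z : ℍ => ((z : ℂ) : OnePoint ℂ)) (𝓝 (w : OnePoint ℂ)) ⊓ l)).NeBot := by
        rw [inf_comm, Filter.push_pull, inf_comm]
        exact h
      rw [h1, map_bot] at h3
      exact h3.ne rfl

/-- Compactness of the Riemann sphere: otherwise the bad points, going off to infinity in `ℍ`, would
accumulate at some ideal point. -/
theorem eventually_cocompact_of_idealNhds {P : ℍ → Prop}
    (h : ∀ ξ, ∀ᶠ z in idealNhds ξ, P z) : ∀ᶠ z in cocompact ℍ, P z := by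
  by_contra hP
  set l := cocompact ℍ ⊓ 𝓟 {z | ¬ P z} with hl
  have hne : l.NeBot := frequently_mem_iff_neBot.mp (not_eventually.mp hP)
  obtain ⟨η, hη⟩ := exists_clusterPt_of_compactSpace
    (map (fun z : ℍ => ((z : ℂ) : OnePoint ℂ)) l)
  obtain ⟨ξ, rfl⟩ := exists_eq_of_clusterPt inf_le_left hη
  have h3 : (map (fun z : ℍ => ((z : ℂ) : OnePoint ℂ)) (l ⊓ idealNhds ξ)).NeBot := by
    rw [idealNhds, Filter.push_pull, inf_comm]
    exact hη
  have h4 := (map_neBot_iff _).mp h3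
  obtain ⟨z, hz1, hz2⟩ := h4.nonempty_of_mem
    (inter_mem_inf (mem_inf_of_right (mem_principal_self _)) (h ξ))
  exact hz1 hz2

/-! ### Gromov products near the ideal boundary -/

theorem expGromov_comm (x z w : ℍ) : expGromov x z w = expGromov x w z := by
  rw [expGromov, expGromov, dist_conj_comm z w, mul_comm (dist (x : ℂ) _)]

theorem im_le_dist_conj (x z : ℍ) : x.im ≤ dist (x : ℂ) (starRingEnd ℂ z) := by
  rw [Complex.dist_eq]
  refine le_trans ?_ (Complex.abs_im_le_norm _)
  rw [Complex.sub_im, Complex.conj_im, coe_im, coe_im]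
  exact le_trans (by linarith [z.im_pos]) (le_abs_self _)

theorem dist_coe_le_dist_conj (z w : ℍ) : dist (z : ℂ) w ≤ dist (z : ℂ) (starRingEnd ℂ w) := by
  have h0 : 0 < 2 * √(z.im * w.im) := by
    have := Real.sqrt_pos.mpr (mul_pos z.im_pos w.im_pos)
    positivity
  have h := (Real.sinh_lt_cosh (dist z w / 2)).le
  rwa [sinh_half_dist, cosh_half_dist, div_le_div_iff_of_pos_right h0] at h

theorem tendsto_conj_idealNhds (x : ℝ) :
    Tendsto (fun z : ℍ => starRingEnd ℂ (z : ℂ)) (idealNhds x) (𝓝 (x : ℂ)) := by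
  have h := (Complex.continuous_conj.tendsto (x : ℂ)).comp (tendsto_coe_idealNhds x)
  rwa [Complex.conj_ofReal] at h

/-- As `z` goes to `∞` and `w` stays bounded, the distances from `z` to `conj x` and to `conj w`
differ by a bounded amount and the latter is at least `1`, so their quotient is bounded. -/
theorem exists_eventually_expGromov_infty_coe_le (x : ℍ) (y : ℝ) :
    ∃ M, ∀ᶠ p in idealNhds (OnePoint.infty) ×ˢ idealNhds y, expGromov x p.1 p.2 ≤ M := by
  set R := dist (x : ℂ) y + 1
  have hx := x.im_pos
  have h1 : ∀ᶠ w : ℍ in idealNhds (y : OnePoint ℝ), dist (x : ℂ) (starRingEnd ℂ w) < R :=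
    (tendsto_const_nhds.dist (tendsto_conj_idealNhds y)).eventually (gt_mem_nhds (lt_add_one _))
  have h2 : ∀ᶠ w : ℍ in idealNhds (y : OnePoint ℝ), ‖(w : ℂ)‖ < ‖(y : ℂ)‖ + 1 :=
    (tendsto_coe_idealNhds y).norm.eventually (gt_mem_nhds (lt_add_one _))
  have h3 := tendsto_norm_idealNhds_infty.eventually (eventually_ge_atTop (‖(y : ℂ)‖ + 2))
  refine ⟨(1 + R) * R / x.im, (h3.prod_mk (h1.and h2)).mono ?_⟩
  rintro ⟨z, w⟩ ⟨hz, hw1, hw2⟩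
  simp only at hz hw1 hw2 ⊢
  have hd : 1 ≤ dist (z : ℂ) (starRingEnd ℂ w) := by
    rw [Complex.dist_eq]
    have := norm_sub_norm_le (z : ℂ) (starRingEnd ℂ w)
    rw [Complex.norm_conj] at this
    linarith
  have ht : dist (x : ℂ) (starRingEnd ℂ z) ≤ dist (z : ℂ) (starRingEnd ℂ w) + R := by
    have e := dist_triangle (z : ℂ) (starRingEnd ℂ w) (starRingEnd ℂ x)
    have e2 : dist (starRingEnd ℂ (w : ℂ)) (starRingEnd ℂ x) = dist (x : ℂ) w := by
      rw [Complex.dist_conj_conj, dist_comm]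
    have e3 := dist_coe_le_dist_conj x w
    rw [dist_conj_comm]
    linarith
  have hR : 0 ≤ R := by positivity
  rw [expGromov, div_le_div_iff₀ (by positivity) hx]
  set d := dist (z : ℂ) (starRingEnd ℂ w)
  have ht' : dist (x : ℂ) (starRingEnd ℂ z) ≤ (1 + R) * d := by nlinarith
  calc dist (x : ℂ) (starRingEnd ℂ z) * dist (x : ℂ) (starRingEnd ℂ w) * x.im
      ≤ ((1 + R) * d) * R * x.im := by gcongr
    _ = _ := by ring

theorem exists_eventually_expGromov_le (x : ℍ) {ξ η : OnePoint ℝ} (h : ξ ≠ η) :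
    ∃ M, ∀ᶠ p in idealNhds ξ ×ˢ idealNhds η, expGromov x p.1 p.2 ≤ M := by
  induction ξ using OnePoint.rec with
  | infty =>
    induction η using OnePoint.rec with
    | infty => exact absurd rfl h
    | coe y => exact exists_eventually_expGromov_infty_coe_le x y
  | coe y =>
    induction η using OnePoint.rec with
    | infty =>
      obtain ⟨M, hM⟩ := exists_eventually_expGromov_infty_coe_le x y
      refine ⟨M, ?_⟩
      rw [prod_comm]
      refine (Filter.eventually_map.mpr (hM.mono ?_))
      rintro ⟨z, w⟩ hzw
      simpa [expGromov_comm x w z] using hzw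
    | coe y' =>
      have hne : dist (y : ℂ) y' ≠ 0 := by
        rw [dist_ne_zero]
        exact fun e => h (by rw [Complex.ofReal_injective e])
      have hl : Tendsto (fun p : ℍ × ℍ => expGromov x p.1 p.2) (idealNhds y ×ˢ idealNhds y')
          (𝓝 (dist (x : ℂ) y * dist (x : ℂ) y' / (x.im * dist (y : ℂ) y'))) := by
        have t1 := (tendsto_conj_idealNhds y).comp
          (tendsto_fst (f := idealNhds y) (g := idealNhds y'))
        have t2 := (tendsto_conj_idealNhds y').comp
          (tendsto_snd (f := idealNhds y) (g := idealNhds y'))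
        have t3 := (tendsto_coe_idealNhds y).comp
          (tendsto_fst (f := idealNhds y) (g := idealNhds y'))
        exact ((tendsto_const_nhds.dist t1).mul (tendsto_const_nhds.dist t2)).div
          ((t3.dist t2).const_mul _) (mul_ne_zero x.im_pos.ne' hne)
      exact ⟨_, (hl.eventually (gt_mem_nhds (lt_add_one _))).mono fun p hp => hp.le⟩

/-- At a finite point the denominator tends to `0`, while the numerator is at least `x.im ^ 2`. At
`∞` the denominator grows at most like the sum of the two factors of the numerator. -/
theorem eventually_lt_expGromov (x : ℍ) (ξ : OnePoint ℝ) (M : ℝ) :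
    ∀ᶠ p in idealNhds ξ ×ˢ idealNhds ξ, M < expGromov x p.1 p.2 := by
  have hx := x.im_pos
  suffices h : ∀ᶠ p in idealNhds ξ ×ˢ idealNhds ξ, |M| + 1 ≤ expGromov x p.1 p.2 from
    h.mono fun p hp => by linarith [le_abs_self M]
  have hM : 0 < |M| + 1 := by positivity
  induction ξ using OnePoint.rec with
  | infty =>
    -- The factor `2` is due to `a * b / (a + b)` being at least half the smaller of `a` and `b`.
    have h1 := tendsto_norm_idealNhds_infty.eventually
      (eventually_ge_atTop (‖(x : ℂ)‖ + 2 * x.im * (|M| + 1)))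
    refine (h1.prod_mk h1).mono ?_
    rintro ⟨z, w⟩ ⟨hz, hw⟩
    simp only at hz hw ⊢
    have key : ∀ u : ℍ, ‖(x : ℂ)‖ + 2 * x.im * (|M| + 1) ≤ ‖(u : ℂ)‖ →
        2 * x.im * (|M| + 1) ≤ dist (x : ℂ) (starRingEnd ℂ u) := by
      intro u hu
      have := norm_sub_norm_le (starRingEnd ℂ (u : ℂ)) (x : ℂ)
      rw [Complex.norm_conj, ← Complex.dist_eq, dist_comm] at this
      linarith
    have ha := key z hz
    have hb := key w hw
    have hd : dist (z : ℂ) (starRingEnd ℂ w) ≤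
        dist (x : ℂ) (starRingEnd ℂ z) + dist (x : ℂ) (starRingEnd ℂ w) := by
      have e := dist_triangle (z : ℂ) x (starRingEnd ℂ w)
      have e3 := dist_coe_le_dist_conj z x
      rw [dist_conj_comm] at e3
      linarith
    have hpos := dist_conj_pos z w
    rw [expGromov, le_div_iff₀ (by positivity)]
    set a := dist (x : ℂ) (starRingEnd ℂ z)
    set b := dist (x : ℂ) (starRingEnd ℂ w)
    have ha0 : 0 < a := dist_conj_pos x z
    have hb0 : 0 < b := dist_conj_pos x w
    have e1 : (|M| + 1) * (x.im * dist (z : ℂ) (starRingEnd ℂ w)) ≤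
        (|M| + 1) * (x.im * (a + b)) := by gcongr
    nlinarith
  | coe y =>
    have t1 := (tendsto_conj_idealNhds y).comp
      (tendsto_snd (f := idealNhds y) (g := idealNhds y))
    have t3 := (tendsto_coe_idealNhds y).comp
      (tendsto_fst (f := idealNhds y) (g := idealNhds y))
    have t := t3.dist t1
    rw [dist_self] at t
    refine (t.eventually (gt_mem_nhds (show 0 < x.im / (|M| + 1) by positivity))).mono ?_
    rintro ⟨z, w⟩ h
    simp only [Function.comp_apply] at h ⊢
    have hpos := dist_conj_pos z w
    rw [expGromov, le_div_iff₀ (by positivity)]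
    rw [lt_div_iff₀ hM] at h
    have e1 := im_le_dist_conj x z
    have e2 := im_le_dist_conj x w
    calc (|M| + 1) * (x.im * dist (z : ℂ) (starRingEnd ℂ w))
        = x.im * (dist (z : ℂ) (starRingEnd ℂ w) * (|M| + 1)) := by ring
      _ ≤ x.im * x.im := by gcongr
      _ ≤ _ := by gcongr

/-! ### Boundary maps of quasi-isometries -/

/-- Quasi-isometries extend to the ideal boundary. -/
theorem exists_tendsto_idealNhds {f : ℍ ≃ₜ ℍ} (hf : IsQuasiIsometry f) (ξ : OnePoint ℝ) :
    ∃ η, Tendsto f (idealNhds ξ) (idealNhds η) := by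
  set l := map f (idealNhds ξ) with hl
  have hlc : l ≤ cocompact ℍ :=
    (map_mono (idealNhds_le_cocompact ξ)).trans f.isClosedEmbedding.tendsto_cocompact
  obtain ⟨_, hη⟩ := exists_clusterPt_of_compactSpace
    (map (fun z : ℍ => ((z : ℂ) : OnePoint ℂ)) l)
  obtain ⟨η, rfl⟩ := exists_eq_of_clusterPt hlc hη
  refine ⟨η, tendsto_comap_iff.mpr (le_nhds_of_unique_clusterPt fun _ hη' => ?_)⟩
  have hη'' : ClusterPt _ (map (fun z : ℍ => ((z : ℂ) : OnePoint ℂ)) l) := hη'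
  obtain ⟨η', rfl⟩ := exists_eq_of_clusterPt hlc hη''
  -- Two distinct limits would give image pairs with bounded Gromov product. The inverse
  -- quasi-isometry keeps it bounded, but the original pairs both approach `ξ`, where it is
  -- unbounded.
  by_contra hne
  obtain ⟨A, B, hA, hB, hg⟩ := hf.symm
  obtain ⟨M, hM⟩ := exists_eventually_expGromov_le (I : ℍ)
    (show η ≠ η' from fun e => hne (by rw [e]))
  obtain ⟨C, hC⟩ := exists_defect_map_le hA hB.le (2 * Real.log (2 * M))
  obtain ⟨U, hU, V, hV, hUV⟩ := mem_prod_iff.mp hM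
  have hlt := eventually_lt_expGromov (f.symm I) ξ (4 * Real.exp (C / 2))
  obtain ⟨W, hW, hWW⟩ := mem_prod_same_iff.mp hlt
  have key : ∀ {ζ : OnePoint ℝ} {U : Set ℍ}, ClusterPt (OnePoint.map Complex.ofReal ζ)
      (map (fun z : ℍ => ((z : ℂ) : OnePoint ℂ)) l) → U ∈ idealNhds ζ → ∃ z ∈ W, f z ∈ U := by
    intro ζ U hζ hU
    have h3 : (map (fun z : ℍ => ((z : ℂ) : OnePoint ℂ)) (l ⊓ idealNhds ζ)).NeBot := by
      rw [idealNhds, Filter.push_pull, inf_comm]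
      exact hζ
    obtain ⟨_, ⟨z, hz, rfl⟩, hz2⟩ := ((map_neBot_iff _).mp h3).nonempty_of_mem
      (inter_mem_inf (image_mem_map hW) hU)
    exact ⟨z, hz, hz2⟩
  obtain ⟨z, hzW, hzU⟩ := key hη hU
  obtain ⟨w, hwW, hwV⟩ := key hη'' hV
  have h1 : expGromov I (f z) (f w) ≤ M := hUV (Set.mk_mem_prod hzU hwV)
  have h2 := hC f.symm hg I (f z) (f w) (defect_le_of_expGromov_le h1)
  rw [f.symm_apply_apply, f.symm_apply_apply] at h2
  have h3 : 4 * Real.exp (C / 2) < expGromov (f.symm I) z w := hWW (Set.mk_mem_prod hzW hwW)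
  have h4 := expGromov_le (f.symm I) z w
  have h5 : Real.exp (defect (f.symm I) z w / 2) ≤ Real.exp (C / 2) :=
    Real.exp_le_exp.mpr (by linarith)
  linarith

theorem inducesOnBoundary_iff {f : ℍ ≃ₜ ℍ} {h : OnePoint ℝ ≃ₜ OnePoint ℝ} :
    InducesOnBoundary f h ↔ ∀ ξ, Tendsto f (idealNhds ξ) (idealNhds (h ξ)) :=
  forall_congr' fun ξ => (tendsto_comap_iff (f := f) (a := idealNhds ξ)
    (g := fun z : ℍ => ((z : ℂ) : OnePoint ℂ))).symm

/-- The boundary map of a quasi-isometry. -/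
noncomputable def boundaryFun (f : QIHomeo) (ξ : OnePoint ℝ) : OnePoint ℝ :=
  (exists_tendsto_idealNhds f.2.2 ξ).choose

theorem tendsto_boundaryFun (f : QIHomeo) (ξ : OnePoint ℝ) :
    Tendsto f.1 (idealNhds ξ) (idealNhds (boundaryFun f ξ)) :=
  (exists_tendsto_idealNhds f.2.2 ξ).choose_spec

theorem boundaryFun_mul (f g : QIHomeo) (ξ : OnePoint ℝ) :
    boundaryFun (f * g) ξ = boundaryFun f (boundaryFun g ξ) :=
  idealNhds_tendsto_unique (tendsto_boundaryFun (f * g) ξ)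
    ((tendsto_boundaryFun f _).comp (tendsto_boundaryFun g ξ))

theorem boundaryFun_one (ξ : OnePoint ℝ) : boundaryFun 1 ξ = ξ :=
  idealNhds_tendsto_unique (tendsto_boundaryFun 1 ξ) tendsto_id

/-- Extension by continuity into a regular space: near `ξ` the map takes values in a closed
neighbourhood, which therefore contains the limits at ideal points near `ξ`. -/
theorem continuous_boundaryFun (f : QIHomeo) : Continuous (boundaryFun f) := by
  have hj := (continuous_onePointMap_ofReal.isClosedEmbedding
    injective_onePointMap_ofReal).isEmbedding
  rw [hj.continuous_iff, continuous_iff_continuousAt]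
  intro ξ
  refine (closed_nhds_basis _).tendsto_right_iff.mpr ?_
  rintro V ⟨hV, hVc⟩
  obtain ⟨U, hU, hUV⟩ := tendsto_boundaryFun f ξ (preimage_mem_comap hV)
  have hU' : ∀ᶠ η in 𝓝 (OnePoint.map Complex.ofReal ξ), U ∈ 𝓝 η := eventually_mem_nhds_iff.mpr hU
  filter_upwards [continuous_onePointMap_ofReal.continuousAt.eventually hU'] with η hη
  refine hVc.mem_of_tendsto (tendsto_comap_iff.mp (tendsto_boundaryFun f η)) ?_
  exact mem_of_superset (preimage_mem_comap hη) hUV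

/-- The action of quasi-isometries on the ideal boundary. -/
noncomputable def boundaryHom : QIHomeo →* (OnePoint ℝ ≃ₜ OnePoint ℝ) where
  toFun f :=
    { toFun := boundaryFun f
      invFun := boundaryFun f⁻¹
      left_inv := fun ξ => by rw [← boundaryFun_mul, inv_mul_cancel, boundaryFun_one]
      right_inv := fun ξ => by rw [← boundaryFun_mul, mul_inv_cancel, boundaryFun_one]
      continuous_toFun := continuous_boundaryFun f
      continuous_invFun := continuous_boundaryFun f⁻¹ }
  map_one' := by ext ξ : 1; exact boundaryFun_one ξ
  map_mul' f g := by ext ξ : 1; exact boundaryFun_mul f g ξ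

theorem tendsto_boundaryHom (f : QIHomeo) (ξ : OnePoint ℝ) :
    Tendsto f.1 (idealNhds ξ) (idealNhds (boundaryHom f ξ)) :=
  tendsto_boundaryFun f ξ

theorem boundaryHom_eq_of_tendsto {f : QIHomeo} {ξ η : OnePoint ℝ}
    (h : Tendsto f.1 (idealNhds ξ) (idealNhds η)) : boundaryHom f ξ = η :=
  idealNhds_tendsto_unique (tendsto_boundaryHom f ξ) h

theorem sameBoundaryMap_iff {f g : QIHomeo} :
    SameBoundaryMap f g ↔ boundaryHom f = boundaryHom g := by
  constructor
  · rintro ⟨h, hf, hg⟩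
    ext ξ : 1
    rw [boundaryHom_eq_of_tendsto (inducesOnBoundary_iff.mp hf ξ),
      boundaryHom_eq_of_tendsto (inducesOnBoundary_iff.mp hg ξ)]
  · intro h
    exact ⟨boundaryHom f, inducesOnBoundary_iff.mpr (tendsto_boundaryHom f),
      inducesOnBoundary_iff.mpr (by rw [h]; exact tendsto_boundaryHom g)⟩

/-- By `sameBoundaryMap_iff` the generating relation is already the kernel of a homomorphism, so
generating a congruence adds nothing. -/
theorem QI.mk_eq_mk_iff {f g : QIHomeo} : QI.mk f = QI.mk g ↔ boundaryHom f = boundaryHom g := by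
  have h1 : QI.mk f = QI.mk g ↔ boundaryCon f g := boundaryCon.eq
  rw [h1]
  constructor
  · intro h
    have hle : boundaryCon ≤ Con.ker boundaryHom :=
      Con.conGen_le.mpr fun x y hxy => sameBoundaryMap_iff.mp hxy
    exact hle h
  · exact fun h => ConGen.Rel.of _ _ (sameBoundaryMap_iff.mpr h)

/-! ### Quasi-isometries fixing two or three boundary points -/

theorem tendsto_inversion_smul {x : ℝ} (hx : x ≠ 0) :
    Tendsto (fun z => inversion • z) (idealNhds x) (idealNhds ((-1 / x : ℝ))) := by
  rw [tendsto_idealNhds_coe]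
  simp only [coe_inversion_smul]
  push_cast
  exact tendsto_const_nhds.div (tendsto_coe_idealNhds x) (by exact_mod_cast hx)

theorem tendsto_axisPoint_atBot : Tendsto axisPoint atBot (idealNhds (0 : ℝ)) := by
  rw [tendsto_idealNhds_coe, Complex.ofReal_zero, tendsto_zero_iff_norm_tendsto_zero]
  refine Real.tendsto_exp_atBot.congr fun s => ?_
  rw [← exp_axisProj, axisProj_axisPoint]

/-- A quasi-isometry fixing the end points of the imaginary axis moves the imaginary axis by a
bounded amount. -/
theorem exists_norm_map_axisPoint_le {A B : ℝ} (hA : 0 < A) (hB : 0 ≤ B) :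
    ∃ C, 0 < C ∧ ∀ f : ℍ → ℍ, QuasiIsometryWith A B f →
      Tendsto f (idealNhds (0 : ℝ)) (idealNhds (0 : ℝ)) →
      Tendsto f (idealNhds OnePoint.infty) (idealNhds OnePoint.infty) →
      ∀ s, ‖(f (axisPoint s) : ℂ)‖ ≤ C * (f (axisPoint s)).im := by
  obtain ⟨C, hC⟩ := exists_defect_map_le hA hB 0
  refine ⟨4 * (4 * Real.exp (C / 2)), by positivity, fun f hf h0 hi s => ?_⟩
  set x := f (axisPoint s)
  have hx := norm_coe_pos x
  have h1 := tendsto_norm_idealNhds_infty.comp (hi.comp tendsto_axisPoint_atTop)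
  have h2 := ((tendsto_coe_idealNhds 0).comp
    (h0.comp (tendsto_axisPoint_atBot.comp tendsto_neg_atTop_atBot))).norm
  rw [Complex.ofReal_zero, norm_zero] at h2
  -- The bound `|s| ≤ u` puts the point between those at `-u` and `u`, so its defect is zero. The
  -- factors `3` and `1 / 2` make `‖z‖ + ‖w‖ ≤ 2 * (‖w‖ - ‖x‖)` for the images `z`, `w` of the ends.
  obtain ⟨u, ⟨hu1, hu2⟩, hu3⟩ := (((h1.eventually (eventually_ge_atTop (3 * ‖(x : ℂ)‖))).and
    (h2.eventually (gt_mem_nhds (show 0 < ‖(x : ℂ)‖ / 2 by positivity)))).and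
    (eventually_ge_atTop |s|)).exists
  simp only [Function.comp_apply] at hu1 hu2
  obtain ⟨hs1, hs2⟩ := abs_le.mp hu3
  have hd := hC f hf (axisPoint s) (axisPoint (-u)) (axisPoint u) (by
    rw [defect, dist_axisPoint, dist_axisPoint, dist_axisPoint, abs_of_nonneg (by linarith),
      abs_of_nonpos (by linarith), abs_of_nonpos (by linarith)]
    linarith)
  have hg : expGromov x (f (axisPoint (-u))) (f (axisPoint u)) ≤ 4 * Real.exp (C / 2) :=
    (expGromov_le _ _ _).trans (by gcongr)
  set z := f (axisPoint (-u))
  set w := f (axisPoint u)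
  have hpos := dist_conj_pos z w
  have hxi := x.im_pos
  rw [expGromov, div_le_iff₀ (by positivity)] at hg
  have e1 : ‖(x : ℂ)‖ / 2 ≤ dist (x : ℂ) (starRingEnd ℂ z) := by
    have := norm_sub_norm_le (x : ℂ) (starRingEnd ℂ z)
    rw [Complex.norm_conj, ← Complex.dist_eq] at this
    linarith
  have e2 : ‖(w : ℂ)‖ - ‖(x : ℂ)‖ ≤ dist (x : ℂ) (starRingEnd ℂ w) := by
    have := norm_sub_norm_le (starRingEnd ℂ (w : ℂ)) (x : ℂ)
    rwa [Complex.norm_conj, ← Complex.dist_eq, dist_comm] at this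
  have e3 : dist (z : ℂ) (starRingEnd ℂ w) ≤ ‖(z : ℂ)‖ + ‖(w : ℂ)‖ := by
    have := norm_sub_le (z : ℂ) (starRingEnd ℂ w)
    rwa [Complex.norm_conj, ← Complex.dist_eq] at this
  have e4 : dist (z : ℂ) (starRingEnd ℂ w) ≤ 2 * dist (x : ℂ) (starRingEnd ℂ w) := by linarith
  have hb := dist_conj_pos x w
  refine le_of_mul_le_mul_right ?_ hb
  have hE := Real.exp_pos (C / 2)
  calc ‖(x : ℂ)‖ * dist (x : ℂ) (starRingEnd ℂ w)
      = 2 * (‖(x : ℂ)‖ / 2 * dist (x : ℂ) (starRingEnd ℂ w)) := by ring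
    _ ≤ 2 * (dist (x : ℂ) (starRingEnd ℂ z) * dist (x : ℂ) (starRingEnd ℂ w)) := by gcongr
    _ ≤ 2 * (4 * Real.exp (C / 2) * (x.im * dist (z : ℂ) (starRingEnd ℂ w))) := by gcongr
    _ ≤ 2 * (4 * Real.exp (C / 2) * (x.im * (2 * dist (x : ℂ) (starRingEnd ℂ w)))) := by gcongr
    _ = _ := by ring

theorem im_toSL2R_smul (a z : ℍ) : (a.toSL2R • z).im = a.im * z.im := by
  rw [← coe_im, coe_toSL2R_smul]; simp

theorem I_eq_axisPoint : (I : ℍ) = axisPoint 0 := by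
  apply UpperHalfPlane.ext; simp [coe_axisPoint]

/-- A quasi-isometry fixing three boundary points moves the centre of the corresponding ideal
triangle by a bounded amount. -/
theorem exists_im_map_I_bounds {A B : ℝ} (hA : 0 < A) (hB : 0 ≤ B) :
    ∃ K, 0 < K ∧ ∀ f : ℍ → ℍ, QuasiIsometryWith A B f →
      Tendsto f (idealNhds (0 : ℝ)) (idealNhds (0 : ℝ)) →
      Tendsto f (idealNhds (1 : ℝ)) (idealNhds (1 : ℝ)) →
      Tendsto f (idealNhds OnePoint.infty) (idealNhds OnePoint.infty) →
      1 ≤ K * (f I).im ∧ (f I).im ≤ K := by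
  obtain ⟨C, hC0, hC⟩ := exists_norm_map_axisPoint_le hA hB
  set a : ℍ := ⟨⟨1, 1⟩, one_pos⟩ with ha
  set a' : ℍ := ⟨⟨-1, 1⟩, one_pos⟩ with ha'
  -- `μ` is `z ↦ z / (z + 1)` and `μ'` is its inverse `z ↦ z / (1 - z)`; `μ` carries the geodesic
  -- from `0` to `∞` to that from `0` to `1`.
  set μ := inversion * a'.toSL2R * inversion with hμ
  set μ' := inversion * a.toSL2R * inversion with hμ'
  set E := A * dist (I : ℍ) (a.toSL2R • I) + B with hE
  set F := A * dist (I : ℍ) (μ • I) + B with hF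
  refine ⟨C + C * Real.exp E + Real.exp E + C * Real.exp F, by positivity,
    fun f hf h0 h1 hi => ?_⟩
  set w := f I with hw
  have hwi := w.im_pos
  constructor
  -- If `w` were very low, then `w` would be close to `0`, and `v`, the image of `1 + i`, close to
  -- `1`, because they stay near the geodesics from `0` and from `1` to `∞`. But `v` and `w` are at
  -- bounded hyperbolic distance.
  · have n0 : ‖(w : ℂ)‖ ≤ C * w.im := by
      have := hC f hf h0 hi 0
      rwa [← I_eq_axisPoint] at this
    set v := f (a.toSL2R • I) with hv
    have t0 : Tendsto (fun z => a.toSL2R • z) (idealNhds (0 : ℝ)) (idealNhds (1 : ℝ)) := by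
      simpa [ha] using tendsto_toSL2R_smul a 0
    have t1 : Tendsto (fun z => a'.toSL2R • z) (idealNhds (1 : ℝ)) (idealNhds (0 : ℝ)) := by
      simpa [ha'] using tendsto_toSL2R_smul a' 1
    have n1 := hC _ (hf.comp_smul a'.toSL2R a.toSL2R) (t1.comp (h1.comp t0))
      ((tendsto_toSL2R_smul_infty a').comp (hi.comp (tendsto_toSL2R_smul_infty a))) 0
    rw [← I_eq_axisPoint, im_toSL2R_smul, coe_toSL2R_smul, ← hv] at n1
    have e1 : ‖(v : ℂ) - 1‖ ≤ C * v.im := by simpa [ha', sub_eq_add_neg] using n1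
    have hd : dist v w ≤ E := by
      rw [dist_comm]; exact (hf _ _).2
    have e2 : v.im ≤ w.im * Real.exp E :=
      (im_le_im_mul_exp_dist v w).trans (by gcongr)
    have e3 : dist (v : ℂ) w ≤ w.im * Real.exp E := by
      refine (dist_coe_le v w).trans ?_
      have : Real.exp (dist v w) ≤ Real.exp E := Real.exp_le_exp.mpr hd
      gcongr
      linarith
    have e4 : (1 : ℝ) ≤ ‖(w : ℂ)‖ + dist (v : ℂ) w + ‖(v : ℂ) - 1‖ := by
      have h := norm_add₃_le (a := (w : ℂ)) (b := (v : ℂ) - w) (c := -((v : ℂ) - 1))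
      rw [norm_neg, ← Complex.dist_eq, show (w : ℂ) + (v - w) + -(v - 1) = 1 by ring,
        norm_one] at h
      exact h
    have e5 : C * v.im ≤ C * (w.im * Real.exp E) := by gcongr
    have e6 : 0 ≤ C * Real.exp F * w.im := by positivity
    linarith
  -- The image `v` of a point on the geodesic from `0` to `1` stays near that geodesic, so its
  -- height is bounded, and `w` is at bounded distance from `v`.
  · have t0 : Tendsto (fun z => μ • z) (idealNhds (0 : ℝ)) (idealNhds (0 : ℝ)) := by
      simp only [hμ, mul_smul]
      exact tendsto_inversion_smul_infty.comp
        ((tendsto_toSL2R_smul_infty a').comp tendsto_inversion_smul_zero)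
    have t0' : Tendsto (fun z => μ' • z) (idealNhds (0 : ℝ)) (idealNhds (0 : ℝ)) := by
      simp only [hμ', mul_smul]
      exact tendsto_inversion_smul_infty.comp
        ((tendsto_toSL2R_smul_infty a).comp tendsto_inversion_smul_zero)
    have t1 : Tendsto (fun z => μ • z) (idealNhds OnePoint.infty) (idealNhds (1 : ℝ)) := by
      simp only [hμ, mul_smul]
      have s1 : Tendsto (fun z => a'.toSL2R • z) (idealNhds (0 : ℝ)) (idealNhds (-1 : ℝ)) := by
        simpa [ha'] using tendsto_toSL2R_smul a' 0
      have s2 : Tendsto (fun z => inversion • z) (idealNhds (-1 : ℝ)) (idealNhds (1 : ℝ)) := by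
        simpa using tendsto_inversion_smul (show (-1 : ℝ) ≠ 0 by norm_num)
      exact s2.comp (s1.comp tendsto_inversion_smul_infty)
    have t1' : Tendsto (fun z => μ' • z) (idealNhds (1 : ℝ)) (idealNhds OnePoint.infty) := by
      simp only [hμ', mul_smul]
      have s1 : Tendsto (fun z => a.toSL2R • z) (idealNhds (-1 : ℝ)) (idealNhds (0 : ℝ)) := by
        simpa [ha] using tendsto_toSL2R_smul a (-1)
      have s2 : Tendsto (fun z => inversion • z) (idealNhds (1 : ℝ)) (idealNhds (-1 : ℝ)) := by
        simpa using tendsto_inversion_smul (show (1 : ℝ) ≠ 0 by norm_num)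
      exact tendsto_inversion_smul_zero.comp (s1.comp s2)
    have n := hC _ (hf.comp_smul μ' μ) (t0'.comp (h0.comp t0)) (t1'.comp (h1.comp t1)) 0
    rw [← I_eq_axisPoint] at n
    set v := f (μ • I) with hv
    have hv0 := v.ne_zero
    have hv1 : (1 - v : ℂ) ≠ 0 := by
      intro h
      have := congrArg Complex.im h
      simp [v.im_ne_zero] at this
    have hc : ((μ' • v : ℍ) : ℂ) = v / (1 - v) := by
      simp only [hμ', mul_smul]
      rw [coe_inversion_smul, coe_toSL2R_smul, coe_inversion_smul]
      have h2 : (a.im * (-1 / v) + a.re : ℂ) ≠ 0 := by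
        have h3 : (a.im * (-1 / v) + a.re : ℂ) = -(1 - v) / v := by
          simp [ha]; field_simp; ring
        rw [h3]
        exact div_ne_zero (neg_ne_zero.mpr hv1) hv0
      rw [div_eq_div_iff h2 hv1]
      simp [ha]
      field_simp
      ring
    have hn : 0 < ‖(1 - v : ℂ)‖ := norm_pos_iff.mpr hv1
    have him : (μ' • v).im = v.im / ‖(1 - v : ℂ)‖ ^ 2 := by
      rw [← coe_im, hc, Complex.div_im, Complex.sq_norm]
      simp
      ring
    rw [hc, him, norm_div] at n
    have n2 : ‖(v : ℂ)‖ * ‖(1 - v : ℂ)‖ ≤ C * ‖(v : ℂ)‖ := by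
      rw [← mul_div_assoc, div_le_div_iff₀ hn (by positivity)] at n
      have : ‖(v : ℂ)‖ * ‖(1 - v : ℂ)‖ * ‖(1 - v : ℂ)‖ ≤ C * v.im * ‖(1 - v : ℂ)‖ := by
        linarith
      refine (le_of_mul_le_mul_right this hn).trans ?_
      have := im_le_norm v
      gcongr
    have n3 : ‖(1 - v : ℂ)‖ ≤ C := by
      rw [mul_comm] at n2
      exact le_of_mul_le_mul_right n2 (norm_coe_pos v)
    have n4 : v.im ≤ C := by
      refine le_trans ?_ n3
      have := Complex.abs_im_le_norm (1 - v : ℂ)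
      simp only [Complex.sub_im, Complex.one_im, zero_sub, abs_neg, coe_im] at this
      exact (le_abs_self _).trans this
    have hd : dist w v ≤ F := (hf _ _).2
    have e2 : w.im ≤ v.im * Real.exp F :=
      (im_le_im_mul_exp_dist w v).trans (mul_le_mul_of_nonneg_left
        (Real.exp_le_exp.mpr hd) v.im_pos.le)
    have e3 : v.im * Real.exp F ≤ C * Real.exp F := by gcongr
    have e4 : 0 ≤ C + C * Real.exp E + Real.exp E := by positivity
    linarith

/-- The height of the image of a point above an interval is comparable to the length of the
image of the interval. -/
theorem exists_im_map_bounds {A B : ℝ} (hA : 0 < A) (hB : 0 ≤ B) :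
    ∃ K, 0 < K ∧ ∀ x₁ x₂ : ℝ, x₁ ≠ x₂ → ∃ a : ℍ, ∀ (f : ℍ → ℍ) (φ : ℝ → ℝ),
      QuasiIsometryWith A B f → StrictMono φ →
      (∀ x : ℝ, Tendsto f (idealNhds x) (idealNhds (φ x))) →
      Tendsto f (idealNhds OnePoint.infty) (idealNhds OnePoint.infty) →
      |φ x₂ - φ x₁| ≤ K * (f a).im ∧ (f a).im ≤ K * |φ x₂ - φ x₁| := by
  obtain ⟨K, hK0, hK⟩ := exists_im_map_I_bounds hA hB
  refine ⟨K, hK0, fun x₁ x₂ hx => ?_⟩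
  wlog hlt : x₁ < x₂ generalizing x₁ x₂
  · obtain ⟨a, ha⟩ := this x₂ x₁ hx.symm (lt_of_le_of_ne (not_lt.mp hlt) hx.symm)
    exact ⟨a, fun f φ h1 h2 h3 h4 => by rw [abs_sub_comm]; exact ha f φ h1 h2 h3 h4⟩
  refine ⟨⟨⟨x₁, x₂ - x₁⟩, sub_pos.mpr hlt⟩, fun f φ hf hφ hb hi => ?_⟩
  set a : ℍ := ⟨⟨x₁, x₂ - x₁⟩, sub_pos.mpr hlt⟩ with ha
  have hl : 0 < φ x₂ - φ x₁ := sub_pos.mpr (hφ hlt)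
  -- `b.toSL2R` is the affine map taking `φ x₁`, `φ x₂` to `0`, `1`. The point `a` depends only on
  -- the interval, so one choice serves all iterates later.
  set b : ℍ := ⟨⟨-φ x₁ / (φ x₂ - φ x₁), 1 / (φ x₂ - φ x₁)⟩, one_div_pos.mpr hl⟩ with hbdef
  have s0 : Tendsto (fun z => a.toSL2R • z) (idealNhds (0 : ℝ)) (idealNhds x₁) := by
    simpa [ha] using tendsto_toSL2R_smul a 0
  have s1 : Tendsto (fun z => a.toSL2R • z) (idealNhds (1 : ℝ)) (idealNhds x₂) := by
    simpa [ha] using tendsto_toSL2R_smul a 1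
  have s2 : Tendsto (fun z => b.toSL2R • z) (idealNhds (φ x₁)) (idealNhds (0 : ℝ)) := by
    have h := tendsto_toSL2R_smul b (φ x₁)
    rwa [show b.im * φ x₁ + b.re = 0 by
      change 1 / (φ x₂ - φ x₁) * φ x₁ + -φ x₁ / (φ x₂ - φ x₁) = 0
      field_simp; ring] at h
  have s3 : Tendsto (fun z => b.toSL2R • z) (idealNhds (φ x₂)) (idealNhds (1 : ℝ)) := by
    have h := tendsto_toSL2R_smul b (φ x₂)
    rwa [show b.im * φ x₂ + b.re = 1 by
      change 1 / (φ x₂ - φ x₁) * φ x₂ + -φ x₁ / (φ x₂ - φ x₁) = 1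
      field_simp; ring] at h
  obtain ⟨h1, h2⟩ := hK _ (hf.comp_smul b.toSL2R a.toSL2R) (s2.comp ((hb _).comp s0))
    (s3.comp ((hb _).comp s1))
    ((tendsto_toSL2R_smul_infty b).comp (hi.comp (tendsto_toSL2R_smul_infty a)))
  rw [toSL2R_smul_I, im_toSL2R_smul, show b.im = 1 / (φ x₂ - φ x₁) from rfl] at h1 h2
  rw [abs_of_pos hl]
  constructor
  · rw [show K * (1 / (φ x₂ - φ x₁) * (f a).im) = K * (f a).im / (φ x₂ - φ x₁) by ring,
      le_div_iff₀ hl] at h1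
    linarith
  · rw [one_div, inv_mul_le_iff₀ hl] at h2
    linarith

/-! ### Dynamics on the boundary -/

theorem exists_real_boundaryMap {f : QIHomeo}
    (hi : boundaryHom f OnePoint.infty = OnePoint.infty) :
    ∃ φ : ℝ → ℝ, Continuous φ ∧ Function.Injective φ ∧ ∀ x : ℝ, boundaryHom f x = φ x := by
  have h : ∀ x : ℝ, ∃ y : ℝ, boundaryHom f x = y := by
    intro x
    have hne : boundaryHom f x ≠ OnePoint.infty := by
      rw [← hi]
      exact fun e => OnePoint.coe_ne_infty x ((boundaryHom f).injective e)
    obtain ⟨y, hy⟩ := OnePoint.ne_infty_iff_exists.mp hne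
    exact ⟨y, hy.symm⟩
  choose φ hφ using h
  refine ⟨φ, ?_, fun x y hxy => ?_, hφ⟩
  · rw [OnePoint.isOpenEmbedding_coe.isEmbedding.continuous_iff]
    exact ((boundaryHom f).continuous.comp OnePoint.continuous_coe).congr hφ
  · refine OnePoint.coe_injective ((boundaryHom f).injective ?_)
    rw [hφ, hφ, hxy]

theorem boundaryHom_pow_coe {f : QIHomeo} {φ : ℝ → ℝ} (hφ : ∀ x : ℝ, boundaryHom f x = φ x)
    (n : ℕ) (x : ℝ) : (boundaryHom f ^ n) (x : OnePoint ℝ) = (φ^[n] x : ℝ) := by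
  induction n generalizing x with
  | zero => rfl
  | succ n ih =>
    rw [pow_succ, Function.iterate_succ_apply, ← ih, ← hφ]
    rfl

theorem boundaryHom_pow_infty {f : QIHomeo}
    (hi : boundaryHom f OnePoint.infty = OnePoint.infty) (n : ℕ) :
    (boundaryHom f ^ n) OnePoint.infty = OnePoint.infty := by
  induction n with
  | zero => rfl
  | succ n ih =>
    rw [pow_succ]
    change (boundaryHom f ^ n) (boundaryHom f OnePoint.infty) = _
    rw [hi, ih]

/-- The powers of `f` have the same boundary maps as quasi-isometries with constants `A`, `B`. -/
def UniformPowers (A B : ℝ) (f : QIHomeo) : Prop :=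
  ∀ n : ℕ, ∃ g : QIHomeo, boundaryHom g = boundaryHom f ^ n ∧ QuasiIsometryWith A B g.1

section

variable {A B : ℝ} {f : QIHomeo} {φ : ℝ → ℝ}

/-- Let `z` lie above the interval between `p` and `a`, and `w` above that between `p` and `t`. The
images of `z` keep a height bounded below, those of `w` would sink to height `0`, yet the ratio of
the heights is bounded by `E`. -/
theorem UniformPowers.not_tendsto (hA : 0 < A) (hB : 0 ≤ B) (hf : UniformPowers A B f)
    (hi : boundaryHom f OnePoint.infty = OnePoint.infty)
    (hφ : ∀ x : ℝ, boundaryHom f x = φ x) (hmono : StrictMono φ) {p a t : ℝ}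
    (hp : φ p = p) (ha : φ a = a) (hap : a ≠ p) (htp : t ≠ p) :
    ¬ Tendsto (fun n => φ^[n] t) atTop (𝓝 p) := by
  intro ht
  obtain ⟨K, hK0, hK⟩ := exists_im_map_bounds hA hB
  obtain ⟨z, hz⟩ := hK p a hap.symm
  obtain ⟨w, hw⟩ := hK p t htp.symm
  set E := Real.exp (A * dist z w + B)
  have key : ∀ n, |a - p| ≤ K * (K * |φ^[n] t - p| * E) := by
    intro n
    obtain ⟨g, hg, hAB⟩ := hf n
    have hm : StrictMono φ^[n] := hmono.iterate n
    have hc : ∀ x : ℝ, Tendsto g.1 (idealNhds x) (idealNhds ((φ^[n] x : ℝ))) := by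
      intro x
      have := tendsto_boundaryHom g x
      rwa [hg, boundaryHom_pow_coe hφ] at this
    have hci : Tendsto g.1 (idealNhds OnePoint.infty) (idealNhds OnePoint.infty) := by
      have := tendsto_boundaryHom g OnePoint.infty
      rwa [hg, boundaryHom_pow_infty hi] at this
    have e1 := (hz g.1 _ hAB hm hc hci).1
    have e2 := (hw g.1 _ hAB hm hc hci).2
    rw [Function.iterate_fixed hp, Function.iterate_fixed ha] at e1
    rw [Function.iterate_fixed hp] at e2
    have e3 : (g.1 z).im ≤ (g.1 w).im * E :=
      (im_le_im_mul_exp_dist _ _).trans (mul_le_mul_of_nonneg_left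
        (Real.exp_le_exp.mpr (hAB _ _).2) (g.1 w).im_pos.le)
    have hE : 0 < E := Real.exp_pos _
    calc |a - p| ≤ K * (g.1 z).im := e1
      _ ≤ K * ((g.1 w).im * E) := by gcongr
      _ ≤ _ := by gcongr
  have hlim : Tendsto (fun n => K * (K * |φ^[n] t - p| * E)) atTop (𝓝 (K * (K * |p - p| * E))) :=
    (((ht.sub_const p).abs.const_mul K).mul_const E).const_mul K
  have := ge_of_tendsto' hlim key
  rw [sub_self, abs_zero, mul_zero, zero_mul, mul_zero] at this
  exact absurd this (not_le.mpr (abs_pos.mpr (sub_ne_zero.mpr hap)))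

/-- If `φ t < t`, the iterates of `t` decrease and are bounded below by the fixed point `c`, so they
converge to a fixed point below `t`, contrary to `UniformPowers.not_tendsto`. -/
theorem UniformPowers.le_map (hA : 0 < A) (hB : 0 ≤ B) (hf : UniformPowers A B f)
    (hi : boundaryHom f OnePoint.infty = OnePoint.infty)
    (hφ : ∀ x : ℝ, boundaryHom f x = φ x) (hmono : StrictMono φ) (hc : Continuous φ)
    (h0 : φ 0 = 0) (h1 : φ 1 = 1) {c t : ℝ} (hct : c < t) (hfc : φ c = c) : t ≤ φ t := by
  by_contra! h
  have hanti := hmono.monotone.antitone_iterate_of_map_le h.le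
  have hbd : BddBelow (Set.range fun n => φ^[n] t) := by
    refine ⟨c, ?_⟩
    rintro _ ⟨n, rfl⟩
    have := (hmono.monotone.iterate n) hct.le
    rwa [Function.iterate_fixed hfc] at this
  have ht := tendsto_atTop_ciInf hanti hbd
  set p := ⨅ n, φ^[n] t
  have hp : φ p = p := isFixedPt_of_tendsto_iterate ht hc.continuousAt
  have hpt : p < t := (ciInf_le hbd 1).trans_lt h
  -- Whichever of `0` and `1` differs from `p` serves as the second fixed point.
  by_cases hp0 : p = 0
  · exact hf.not_tendsto hA hB hi hφ hmono hp h1 (by rw [hp0]; exact one_ne_zero) hpt.ne' ht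
  · exact hf.not_tendsto hA hB hi hφ hmono hp h0 (Ne.symm hp0) hpt.ne' ht

theorem UniformPowers.map_le (hA : 0 < A) (hB : 0 ≤ B) (hf : UniformPowers A B f)
    (hi : boundaryHom f OnePoint.infty = OnePoint.infty)
    (hφ : ∀ x : ℝ, boundaryHom f x = φ x) (hmono : StrictMono φ) (hc : Continuous φ)
    (h0 : φ 0 = 0) (h1 : φ 1 = 1) {c t : ℝ} (hct : t < c) (hfc : φ c = c) : φ t ≤ t := by
  by_contra! h
  have hanti := hmono.monotone.monotone_iterate_of_le_map h.le
  have hbd : BddAbove (Set.range fun n => φ^[n] t) := by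
    refine ⟨c, ?_⟩
    rintro _ ⟨n, rfl⟩
    have := (hmono.monotone.iterate n) hct.le
    rwa [Function.iterate_fixed hfc] at this
  have ht := tendsto_atTop_ciSup hanti hbd
  set p := ⨆ n, φ^[n] t
  have hp : φ p = p := isFixedPt_of_tendsto_iterate ht hc.continuousAt
  have hpt : t < p := h.trans_le (le_ciSup hbd 1)
  by_cases hp0 : p = 0
  · exact hf.not_tendsto hA hB hi hφ hmono hp h1 (by rw [hp0]; exact one_ne_zero) hpt.ne ht
  · exact hf.not_tendsto hA hB hi hφ hmono hp h0 (Ne.symm hp0) hpt.ne ht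

/-- If the powers of `f` and of its inverse are uniform quasi-isometries and `f` fixes three
boundary points, then `f` is trivial on the boundary. -/
theorem UniformPowers.boundaryHom_eq_one (hA : 0 < A) (hB : 0 ≤ B) (hf : UniformPowers A B f)
    (hf' : UniformPowers A B f⁻¹) (hi : boundaryHom f OnePoint.infty = OnePoint.infty)
    (hφ : ∀ x : ℝ, boundaryHom f x = φ x) (hmono : StrictMono φ) (hc : Continuous φ)
    (h0 : φ 0 = 0) (h1 : φ 1 = 1) : boundaryHom f = 1 := by
  have hinv : ∀ ξ, boundaryHom f⁻¹ (boundaryHom f ξ) = ξ := by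
    intro ξ
    rw [map_inv]
    exact (boundaryHom f).symm_apply_apply ξ
  have hinv' : ∀ ξ, boundaryHom f (boundaryHom f⁻¹ ξ) = ξ := by
    intro ξ
    rw [map_inv]
    exact (boundaryHom f).apply_symm_apply ξ
  have hi' : boundaryHom f⁻¹ OnePoint.infty = OnePoint.infty := by
    have := hinv OnePoint.infty
    rwa [hi] at this
  obtain ⟨ψ, hψc, -, hψ⟩ := exists_real_boundaryMap hi'
  have hψφ : ∀ x, ψ (φ x) = x := fun x => OnePoint.coe_injective (by rw [← hψ, ← hφ, hinv])
  have hφψ : ∀ x, φ (ψ x) = x := fun x => OnePoint.coe_injective (by rw [← hφ, ← hψ, hinv'])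
  have hψm : StrictMono ψ := fun x y hxy => by
    rw [← hmono.lt_iff_lt, hφψ, hφψ]; exact hxy
  have h0' : ψ 0 = 0 := by have := hψφ 0; rwa [h0] at this
  have h1' : ψ 1 = 1 := by have := hψφ 1; rwa [h1] at this
  have key : ∀ t, φ t = t := by
    intro t
    -- Positive points lie to the right of the fixed point `0`, all others to the left of `1`. The
    -- inequality for the inverse `ψ` turns into the opposite one for `φ`.
    rcases lt_or_ge 0 t with h | h
    · have e1 := hf.le_map hA hB hi hφ hmono hc h0 h1 h h0
      have e2 := hf'.le_map hA hB hi' hψ hψm hψc h0' h1' h h0'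
      have e3 := hmono.monotone e2
      rw [hφψ] at e3
      exact le_antisymm e3 e1
    · have h' : t < 1 := by linarith
      have e1 := hf.map_le hA hB hi hφ hmono hc h0 h1 h' h1
      have e2 := hf'.map_le hA hB hi' hψ hψm hψc h0' h1' h' h1'
      have e3 := hmono.monotone e2
      rw [hφψ] at e3
      exact le_antisymm e1 e3
  ext ξ : 1
  induction ξ using OnePoint.rec with
  | infty => exact hi
  | coe x => rw [hφ, key]; rfl

end

/-! ### Winding numbers and orientation -/

theorem eq_of_exp_eq_const {k : C(unitInterval, ℂ)} {c : ℂ} (h : ∀ t, Complex.exp (k t) = c)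
    (s t : unitInterval) : k s = k t := by
  have h1 : ∀ u, ∃ n : ℤ, k u = k s + n * (2 * Real.pi * Complex.I) := fun u =>
    Complex.exp_eq_exp_iff_exists_int.mp ((h u).trans (h s).symm)
  choose N hN using h1
  have hpi : (2 * Real.pi * Complex.I : ℂ) ≠ 0 := Complex.two_pi_I_ne_zero
  have hc : Continuous N := by
    rw [Int.isClosedEmbedding_coe_real.isEmbedding.continuous_iff]
    have : ((↑) : ℤ → ℝ) ∘ N = fun u => ((k u - k s) / (2 * Real.pi * Complex.I)).re := by
      ext u
      rw [hN u, add_sub_cancel_left, mul_div_cancel_right₀ _ hpi]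
      simp
    rw [this]
    fun_prop
  have h2 : N s = N t := PreconnectedSpace.constant inferInstance hc
  rw [hN s, hN t, h2]

theorem div_mem_slitPlane_of_im_neg {a b : ℂ} (ha : a.im < 0) (hb : b.im < 0) :
    a / b ∈ Complex.slitPlane := by
  rw [Complex.mem_slitPlane_iff_not_le_zero, Complex.le_def]
  rintro ⟨h1, h2⟩
  have hb0 : b ≠ 0 := fun h => by simp [h] at hb
  have e : a = a / b * b := (div_mul_cancel₀ a hb0).symm
  have e2 := congrArg Complex.im e
  rw [Complex.mul_im] at e2
  simp only [Complex.zero_re, Complex.zero_im] at h1 h2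
  rw [h2, zero_mul, add_zero] at e2
  nlinarith

theorem div_conj_mem_slitPlane {a : ℂ} (ha : 0 < a.re) :
    a / starRingEnd ℂ a ∈ Complex.slitPlane := by
  rw [Complex.mem_slitPlane_iff_not_le_zero, Complex.le_def]
  rintro ⟨h1, h2⟩
  have ha0 : starRingEnd ℂ a ≠ 0 := by
    rw [Ne, map_eq_zero]; exact fun h => by simp [h] at ha
  have e : a = a / starRingEnd ℂ a * starRingEnd ℂ a := (div_mul_cancel₀ a ha0).symm
  have e2 := congrArg Complex.re e
  rw [Complex.mul_re] at e2
  simp only [Complex.zero_re, Complex.zero_im] at h1 h2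
  rw [h2, zero_mul, sub_zero, Complex.conj_re] at e2
  nlinarith

theorem tendsto_sub_div_sub {α : Type*} {l : Filter α} {u : α → ℂ}
    (hu : Tendsto (fun x => ‖u x‖) l atTop) (a c : ℂ) :
    Tendsto (fun x => (u x - a) / (u x - c)) l (𝓝 1) := by
  have h1 : Tendsto (fun x => ‖u x - c‖) l atTop := by
    refine tendsto_atTop_mono (fun x => ?_) (tendsto_atTop_add_const_right l (-‖c‖) hu)
    have := norm_sub_norm_le (u x) c
    linarith
  have h2 : Tendsto (fun x => (u x - c)⁻¹) l (𝓝 0) := by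
    rw [tendsto_zero_iff_norm_tendsto_zero]
    simp only [norm_inv]
    exact h1.inv_tendsto_atTop
  have h3 : Tendsto (fun x => 1 + (c - a) * (u x - c)⁻¹) l (𝓝 (1 + (c - a) * 0)) :=
    tendsto_const_nhds.add (h2.const_mul _)
  rw [mul_zero, add_zero] at h3
  refine h3.congr' ?_
  filter_upwards [h1.eventually (eventually_gt_atTop 0)] with x hx
  have : u x - c ≠ 0 := norm_pos_iff.mp hx
  field_simp
  ring

/-- The Cayley transform turns rotations around `i` into Euclidean ones around `0`, so arguments
along hyperbolic circles are explicit. -/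
theorem ellipticRotation_cayley (θ : ℝ) (z : ℍ) :
    ((ellipticRotation θ • z : ℍ) - Complex.I : ℂ) / ((ellipticRotation θ • z : ℍ) + Complex.I) =
      Complex.exp (2 * θ * Complex.I) * ((z - Complex.I) / (z + Complex.I)) := by
  have hd := ellipticRotation_denom_ne_zero θ z
  have hne : ∀ w : ℍ, (w + Complex.I : ℂ) ≠ 0 := by
    intro w h
    have := congrArg Complex.im h
    simp at this
    linarith [w.im_pos]
  have h1 := hne (ellipticRotation θ • z)
  have h2 := hne z
  have he : Complex.exp (2 * θ * Complex.I) =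
      (Complex.cos θ + Complex.sin θ * Complex.I) ^ 2 := by
    rw [← Complex.exp_mul_I, ← Complex.exp_nat_mul]
    congr 1
    push_cast
    ring
  rw [he, ← mul_div_assoc, div_eq_div_iff h1 h2]
  rw [coe_ellipticRotation_smul] at h1 ⊢
  rw [Complex.ofReal_cos, Complex.ofReal_sin] at hd h1 ⊢
  have hs := Complex.sin_sq_add_cos_sq (θ : ℂ)
  set c := Complex.cos θ
  set s := Complex.sin θ
  have e1 : (c * z + s) / (-s * z + c) - Complex.I =
      ((c + s * Complex.I) * (z - Complex.I)) / (-s * z + c) := by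
    rw [eq_div_iff hd, sub_mul, div_mul_cancel₀ _ hd]
    linear_combination s * Complex.I_mul_I
  have e2 : (c * z + s) / (-s * z + c) + Complex.I =
      ((c - s * Complex.I) * (z + Complex.I)) / (-s * z + c) := by
    rw [eq_div_iff hd, add_mul, div_mul_cancel₀ _ hd]
    linear_combination s * Complex.I_mul_I
  have e3 : (c + s * Complex.I) * (c - s * Complex.I) = 1 := by
    linear_combination hs - s ^ 2 * Complex.I_mul_I
  rw [e1, e2]
  rw [div_mul_eq_mul_div, ← mul_div_assoc]
  congr 1
  linear_combination (-(c + s * Complex.I) * (z - Complex.I) * (z + Complex.I)) * e3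

theorem ellipticRotation_pi_smul (z : ℍ) : ellipticRotation Real.pi • z = z := by
  apply UpperHalfPlane.ext
  rw [coe_ellipticRotation_smul]
  simp

theorem ellipticRotation_zero_smul (z : ℍ) : ellipticRotation 0 • z = z := by
  apply UpperHalfPlane.ext
  rw [coe_ellipticRotation_smul]
  simp

/-- The hyperbolic circle of radius `s` around `i`. -/
noncomputable def hyperbolicCircle (s : ℝ) : C(unitInterval, ℍ) :=
  ⟨fun t => ellipticRotation (Real.pi * t) • axisPoint s,
    (continuous_ellipticRotation_smul _).comp (by fun_prop)⟩

theorem hyperbolicCircle_one (s : ℝ) : hyperbolicCircle s 1 = hyperbolicCircle s 0 := by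
  change ellipticRotation (Real.pi * (1 : ℝ)) • axisPoint s =
    ellipticRotation (Real.pi * (0 : ℝ)) • axisPoint s
  rw [mul_one, mul_zero, ellipticRotation_pi_smul, ellipticRotation_zero_smul]

theorem dist_hyperbolicCircle {s : ℝ} (hs : 0 ≤ s) (t : unitInterval) :
    dist (hyperbolicCircle s t) I = s := by
  change dist (ellipticRotation (Real.pi * t) • axisPoint s) I = s
  rw [← ellipticRotation_smul_I (Real.pi * t), dist_smul, I_eq_axisPoint, dist_axisPoint, sub_zero,
    abs_of_nonneg hs]

theorem hyperbolicCircle_cayley (s : ℝ) (t : unitInterval) :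
    ((hyperbolicCircle s t : ℂ) - Complex.I) / ((hyperbolicCircle s t : ℂ) + Complex.I) =
      Complex.exp (2 * Real.pi * t * Complex.I) *
        (((axisPoint s : ℂ) - Complex.I) / ((axisPoint s : ℂ) + Complex.I)) := by
  have h := ellipticRotation_cayley (Real.pi * t) (axisPoint s)
  push_cast at h
  rw [← mul_assoc] at h
  exact h

theorem add_mul_I_mem_slitPlane {w : ℂ} {b : ℝ} (hw : 0 < w.im) (hb : 0 < b) :
    w + b * Complex.I ∈ Complex.slitPlane := by
  refine Complex.mem_slitPlane_iff.mpr (Or.inr ?_)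
  simp
  linarith

theorem axisPoint_cayley_ne_zero {s : ℝ} (hs : 0 < s) :
    ((axisPoint s : ℂ) - Complex.I) / ((axisPoint s : ℂ) + Complex.I) ≠ 0 := by
  refine div_ne_zero (fun h => ?_) (fun h => ?_)
  · rw [sub_eq_zero, ← coe_I, coe_inj, I_eq_axisPoint] at h
    have := dist_axisPoint s 0
    rw [h, dist_self, sub_zero, abs_of_pos hs] at this
    exact hs.ne this
  · have := congrArg Complex.im h
    rw [Complex.add_im, coe_im, Complex.I_im, Complex.zero_im] at this
    linarith [(axisPoint s).im_pos]

/-- The Cayley coordinate turns once around `0`, while its denominator `z + i` stays in the upper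
half plane and contributes nothing. -/
theorem hasWindingNumber_hyperbolicCircle {s : ℝ} (hs : 0 < s) :
    HasWindingNumber (hyperbolicCircle s) I 1 := by
  have hsl : ∀ t, (hyperbolicCircle s t : ℂ) + Complex.I ∈ Complex.slitPlane := fun t => by
    simpa using add_mul_I_mem_slitPlane (hyperbolicCircle s t).im_pos one_pos
  have hγ : Continuous fun t => (hyperbolicCircle s t : ℂ) :=
    continuous_coe.comp (hyperbolicCircle s).continuous
  set u := ((axisPoint s : ℂ) - Complex.I) / ((axisPoint s : ℂ) + Complex.I)
  refine ⟨⟨fun t => 2 * Real.pi * t * Complex.I + Complex.log u +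
    Complex.log ((hyperbolicCircle s t : ℂ) + Complex.I), ?_⟩, fun t => ?_, ?_⟩
  · exact Continuous.add (by fun_prop) ((hγ.add continuous_const).clog hsl)
  · have h0 := Complex.slitPlane_ne_zero (hsl t)
    change Complex.exp (_ + _ + _) = _
    rw [Complex.exp_add, Complex.exp_add, Complex.exp_log (axisPoint_cayley_ne_zero hs),
      Complex.exp_log h0, ← hyperbolicCircle_cayley, div_mul_cancel₀ _ h0, coe_I]
  · simp [hyperbolicCircle_one]

theorem tendsto_neg_conj_map {l : Filter ℍ} {f : ℍ → ℍ} {y : ℝ}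
    (h : Tendsto f l (idealNhds y)) :
    Tendsto (fun z => -starRingEnd ℂ (f z : ℂ)) l (𝓝 ((-y : ℝ) : ℂ)) := by
  have := ((tendsto_conj_idealNhds y).comp h).neg
  push_cast
  exact this

/-- An orientation preserving quasi-isometry fixing `∞` cannot reverse the order of the boundary. -/
theorem not_strictAnti_of_map_zero {f : QIHomeo}
    (hi : boundaryHom f OnePoint.infty = OnePoint.infty) {φ : ℝ → ℝ}
    (hφ : ∀ x : ℝ, boundaryHom f x = φ x) (h0 : φ 0 = 0) : ¬ StrictAnti φ := by
  intro hanti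
  set W : ℍ → ℂ := fun z => -starRingEnd ℂ (f.1 z : ℂ) with hW
  have hWim : ∀ z, (W z).im = (f.1 z).im := fun z => by simp [hW]
  set b := (f.1 I).im with hb
  have hb0 : 0 < b := (f.1 I).im_pos
  -- The reflection `W` undoes the reversal of the boundary. The quotient `r` moves the base point
  -- from `W I` to `b * i`, and `v` compares the Cayley coordinates of `W z` and `z`. Once both
  -- avoid the slit near the boundary, `W` winds exactly as the identity does.
  set r : ℍ → ℂ := fun z => (W z - W I) / (W z - b * Complex.I) with hr
  set v : ℍ → ℂ := fun z => (W z - b * Complex.I) * (z + Complex.I) /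
    ((W z + b * Complex.I) * (z - Complex.I)) with hv
  have hev : ∀ᶠ z in cocompact ℍ, r z ∈ Complex.slitPlane ∧ v z ∈ Complex.slitPlane := by
    refine eventually_cocompact_of_idealNhds fun ξ => ?_
    have hξ := tendsto_boundaryHom f ξ
    induction ξ using OnePoint.rec with
    | infty =>
      rw [hi, tendsto_idealNhds_infty] at hξ
      have hWn : Tendsto (fun z => ‖W z‖) (idealNhds OnePoint.infty) atTop := by
        simpa [hW] using hξ
      have t1 := tendsto_sub_div_sub hWn (W I) (b * Complex.I)
      have t2 := (tendsto_sub_div_sub hWn (b * Complex.I) (-(b * Complex.I))).mul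
        (tendsto_sub_div_sub tendsto_norm_idealNhds_infty (-Complex.I) Complex.I)
      rw [one_mul] at t2
      have hopen := Complex.isOpen_slitPlane.mem_nhds Complex.one_mem_slitPlane
      filter_upwards [t1.eventually hopen, t2.eventually hopen] with z h1 h2
      refine ⟨h1, ?_⟩
      rw [div_mul_div_comm, sub_neg_eq_add, sub_neg_eq_add] at h2
      exact h2
    | coe x =>
      rw [hφ] at hξ
      have t0 := tendsto_neg_conj_map hξ
      have t1 := tendsto_coe_idealNhds x
      set y : ℝ := -φ x with hy
      -- Since `y` has the sign of `x`, the number `(y - b * i) * (x + i)` has real part `y * x + b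
      -- > 0`. The limit of `v` is its quotient by its conjugate, which is not a nonpositive real.
      have hxy : 0 ≤ y * x := by
        rcases le_total 0 x with h | h
        · have := hanti.antitone h
          rw [h0] at this
          exact mul_nonneg (by linarith) h
        · have := hanti.antitone h
          rw [h0] at this
          exact mul_nonneg_of_nonpos_of_nonpos (by linarith) h
      have him1 : ((y : ℂ) - W I).im < 0 := by simp [hWim, ← hb, hb0]
      have him2 : ((y : ℂ) - b * Complex.I).im < 0 := by simp [hb0]
      have hD1 : (y : ℂ) - b * Complex.I ≠ 0 := fun h => by simp [h] at him2
      have hN : starRingEnd ℂ (((y : ℂ) - b * Complex.I) * (x + Complex.I)) =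
          (y + b * Complex.I) * (x - Complex.I) := by
        simp only [map_mul, map_sub, map_add, Complex.conj_ofReal, Complex.conj_I]
        ring
      have hre : 0 < (((y : ℂ) - b * Complex.I) * (x + Complex.I)).re := by
        simp
        linarith
      have hD2 : ((y : ℂ) + b * Complex.I) * (x - Complex.I) ≠ 0 := by
        rw [← hN, Ne, map_eq_zero]
        exact fun h => by rw [h] at hre; simp at hre
      have t2 : Tendsto r (idealNhds x) (𝓝 (((y : ℂ) - W I) / (y - b * Complex.I))) :=
        (t0.sub_const _).div (t0.sub_const _) hD1
      have t3 : Tendsto v (idealNhds x) (𝓝 ((((y : ℂ) - b * Complex.I) * (x + Complex.I)) /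
          ((y + b * Complex.I) * (x - Complex.I)))) :=
        ((t0.sub_const _).mul (t1.add_const _)).div ((t0.add_const _).mul (t1.sub_const _)) hD2
      have m3 := div_conj_mem_slitPlane hre
      rw [hN] at m3
      exact (t2.eventually (Complex.isOpen_slitPlane.mem_nhds
        (div_mem_slitPlane_of_im_neg him1 him2))).and
        (t3.eventually (Complex.isOpen_slitPlane.mem_nhds m3))
  obtain ⟨K, hK, hKs⟩ := mem_cocompact.mp hev
  obtain ⟨R, hR⟩ := hK.isBounded.subset_closedBall I
  set s := |R| + 1 with hs
  have hs0 : 0 < s := by positivity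
  set γ := hyperbolicCircle s with hγ
  have hgood : ∀ t, r (γ t) ∈ Complex.slitPlane ∧ v (γ t) ∈ Complex.slitPlane := by
    refine fun t => hKs fun hmem => ?_
    have h1 := Metric.mem_closedBall.mp (hR hmem)
    rw [dist_hyperbolicCircle hs0.le] at h1
    linarith [le_abs_self R]
  obtain ⟨θ, hθ1, hθ2⟩ := (f.2.1 γ I 1).mp (hasWindingNumber_hyperbolicCircle hs0)
  have hγc : Continuous fun t => (γ t : ℂ) := continuous_coe.comp γ.continuous
  have hWc : Continuous fun t => W (γ t) :=
    (Complex.continuous_conj.comp (continuous_coe.comp (f.1.continuous.comp γ.continuous))).neg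
  set u := ((axisPoint s : ℂ) - Complex.I) / ((axisPoint s : ℂ) + Complex.I) with hu
  have hu0 : u ≠ 0 := axisPoint_cayley_ne_zero hs0
  have hWs : ∀ t, W (γ t) + b * Complex.I ∈ Complex.slitPlane := fun t =>
    add_mul_I_mem_slitPlane (by rw [hWim]; exact (f.1 (γ t)).im_pos) hb0
  have hne1 : ∀ t, W (γ t) - b * Complex.I ≠ 0 := fun t h => by
    refine Complex.slitPlane_ne_zero (hgood t).1 ?_
    simp only [hr, h, div_zero]
  have hne2 : ∀ t, (γ t : ℂ) - Complex.I ≠ 0 := fun t h => by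
    refine Complex.slitPlane_ne_zero (hgood t).2 ?_
    simp only [hv, h, mul_zero, div_zero]
  have hne3 : ∀ t, (γ t : ℂ) + Complex.I ≠ 0 := fun t =>
    Complex.slitPlane_ne_zero (by
      simpa using add_mul_I_mem_slitPlane (γ t).im_pos one_pos)
  have hrc : Continuous fun t => r (γ t) :=
    (hWc.sub continuous_const).div (hWc.sub continuous_const) hne1
  have hvc : Continuous fun t => v (γ t) :=
    ((hWc.sub continuous_const).mul (hγc.add continuous_const)).div
      ((hWc.add continuous_const).mul (hγc.sub continuous_const))
      fun t => mul_ne_zero (Complex.slitPlane_ne_zero (hWs t)) (hne2 t)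
  -- `k` compares an explicit logarithm of `W (γ t) - W I` with the conjugate of `θ`, a logarithm of
  -- its negative; it must therefore be constant.
  let k : C(unitInterval, ℂ) := ⟨fun t => Complex.log (r (γ t)) + Complex.log (v (γ t)) +
    Complex.log (W (γ t) + b * Complex.I) + (2 * Real.pi * t * Complex.I + Complex.log u) -
      starRingEnd ℂ (θ t), by
    refine Continuous.sub (Continuous.add (Continuous.add (Continuous.add ?_ ?_) ?_) ?_) ?_
    · exact hrc.clog fun t => (hgood t).1
    · exact hvc.clog fun t => (hgood t).2
    · exact (hWc.add continuous_const).clog hWs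
    · fun_prop
    · exact Complex.continuous_conj.comp θ.continuous⟩
  have hk : ∀ t, Complex.exp (k t) = -1 := by
    intro t
    have e0 : Complex.exp (starRingEnd ℂ (θ t)) = -(W (γ t) - W I) := by
      rw [Complex.exp_conj, hθ1, map_sub]
      change starRingEnd ℂ (f.1 (γ t) : ℂ) - starRingEnd ℂ (f.1 I : ℂ) =
        -(-starRingEnd ℂ (f.1 (γ t) : ℂ) - -starRingEnd ℂ (f.1 I : ℂ))
      ring
    have e1 : Complex.exp (2 * Real.pi * t * Complex.I) * u =
        ((γ t : ℂ) - Complex.I) / ((γ t : ℂ) + Complex.I) := (hyperbolicCircle_cayley s t).symm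
    have hn0 : W (γ t) - W I ≠ 0 := by
      have := Complex.exp_ne_zero (starRingEnd ℂ (θ t))
      rw [e0] at this
      exact neg_ne_zero.mp this
    change Complex.exp (_ + _ + _ + (_ + _) - _) = _
    rw [Complex.exp_sub, Complex.exp_add, Complex.exp_add, Complex.exp_add, Complex.exp_add,
      Complex.exp_log (Complex.slitPlane_ne_zero (hgood t).1),
      Complex.exp_log (Complex.slitPlane_ne_zero (hgood t).2),
      Complex.exp_log (Complex.slitPlane_ne_zero (hWs t)), Complex.exp_log hu0, e0, e1]
    simp only [hr, hv]
    have n1 := hne1 t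
    have n2 := hne2 t
    have n3 := hne3 t
    have n4 := Complex.slitPlane_ne_zero (hWs t)
    field_simp
  have h1 := eq_of_exp_eq_const hk 1 0
  have hγ1 : γ 1 = γ 0 := hyperbolicCircle_one s
  -- The explicit part gains `2 * π * i`, while conjugation makes `θ` lose as much, so `k` would
  -- increase by `4 * π * i`.
  have h2 : k 1 - k 0 = 2 * Real.pi * Complex.I - starRingEnd ℂ (θ 1 - θ 0) := by
    simp only [k, ContinuousMap.coe_mk, hγ1, map_sub]
    simp
    ring
  rw [h1, sub_self, hθ2] at h2
  simp only [Int.cast_one, one_mul, map_mul, Complex.conj_ofReal, Complex.conj_I,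
    Complex.conj_ofNat] at h2
  have h3 : (2 * Real.pi * Complex.I : ℂ) = 0 := by linear_combination (-1 / 2 : ℂ) * h2
  exact Complex.two_pi_I_ne_zero h3

/-! ### Normalisation and conclusion -/

/-- Möbius transformations as quasi-isometries. -/
noncomputable def moebiusQI : Matrix.SpecialLinearGroup (Fin 2) ℝ →* QIHomeo :=
  moebiusHomeo.codRestrict QIHomeo moebius_mem

theorem boundaryHom_moebiusQI {g : Matrix.SpecialLinearGroup (Fin 2) ℝ} {ξ η : OnePoint ℝ}
    (h : Tendsto (fun z => g • z) (idealNhds ξ) (idealNhds η)) :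
    boundaryHom (moebiusQI g) ξ = η :=
  boundaryHom_eq_of_tendsto h

theorem boundaryHom_mul_apply (f g : QIHomeo) (ξ : OnePoint ℝ) :
    boundaryHom (f * g) ξ = boundaryHom f (boundaryHom g ξ) := by
  rw [map_mul]; rfl

/-- A continuous injection of the line is strictly monotone; a translation makes it fix `0`, where
the winding argument rules out the decreasing case. -/
theorem exists_strictMono_boundaryMap {f : QIHomeo}
    (hi : boundaryHom f OnePoint.infty = OnePoint.infty) :
    ∃ φ : ℝ → ℝ, Continuous φ ∧ StrictMono φ ∧ ∀ x : ℝ, boundaryHom f x = φ x := by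
  obtain ⟨φ, hc, hinj, hφ⟩ := exists_real_boundaryMap hi
  refine ⟨φ, hc, (hc.strictMono_of_inj hinj).resolve_right fun hanti => ?_, hφ⟩
  set a : ℍ := ⟨⟨-φ 0, 1⟩, one_pos⟩ with ha
  refine not_strictAnti_of_map_zero (f := moebiusQI a.toSL2R * f) (φ := fun x => φ x - φ 0)
    ?_ (fun x => ?_) (sub_self _) (fun x y hxy => sub_lt_sub_right (hanti hxy) _)
  · rw [boundaryHom_mul_apply, hi, boundaryHom_moebiusQI (tendsto_toSL2R_smul_infty a)]
  · rw [boundaryHom_mul_apply, hφ, boundaryHom_moebiusQI (tendsto_toSL2R_smul a (φ x))]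
    simp [ha, sub_eq_add_neg]

theorem exists_moebiusQI_infty (f : QIHomeo) : ∃ g : Matrix.SpecialLinearGroup (Fin 2) ℝ,
    boundaryHom (moebiusQI g * f) OnePoint.infty = OnePoint.infty := by
  generalize h : boundaryHom f OnePoint.infty = ξ
  induction ξ using OnePoint.rec with
  | infty => exact ⟨1, by rwa [map_one, one_mul]⟩
  | coe y =>
    set a : ℍ := ⟨⟨-y, 1⟩, one_pos⟩ with ha
    refine ⟨inversion * a.toSL2R, ?_⟩
    have h1 := tendsto_toSL2R_smul a y
    rw [show a.im * y + a.re = 0 by simp [ha]] at h1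
    rw [map_mul moebiusQI, mul_assoc, boundaryHom_mul_apply, boundaryHom_mul_apply, h,
      boundaryHom_moebiusQI h1, boundaryHom_moebiusQI tendsto_inversion_smul_zero]

/-- Every quasi-isometry can be normalised by a Möbius transformation to fix `0`, `1` and `∞`. -/
theorem exists_moebiusQI_normalise (f : QIHomeo) : ∃ (g : Matrix.SpecialLinearGroup (Fin 2) ℝ)
    (φ : ℝ → ℝ), boundaryHom (moebiusQI g * f) OnePoint.infty = OnePoint.infty ∧
      Continuous φ ∧ StrictMono φ ∧ (∀ x : ℝ, boundaryHom (moebiusQI g * f) x = φ x) ∧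
      φ 0 = 0 ∧ φ 1 = 1 := by
  obtain ⟨g, hg⟩ := exists_moebiusQI_infty f
  obtain ⟨φ, -, hm, hφ⟩ := exists_strictMono_boundaryMap hg
  have hl : 0 < φ 1 - φ 0 := sub_pos.mpr (hm one_pos)
  set a : ℍ := ⟨⟨-φ 0 / (φ 1 - φ 0), 1 / (φ 1 - φ 0)⟩, one_div_pos.mpr hl⟩ with ha
  have hinf : boundaryHom (moebiusQI (a.toSL2R * g) * f) OnePoint.infty = OnePoint.infty := by
    rw [map_mul moebiusQI, mul_assoc, boundaryHom_mul_apply, hg,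
      boundaryHom_moebiusQI (tendsto_toSL2R_smul_infty a)]
  have hval : ∀ x : ℝ, boundaryHom (moebiusQI (a.toSL2R * g) * f) x =
      ((1 / (φ 1 - φ 0) * φ x + -φ 0 / (φ 1 - φ 0) : ℝ) : OnePoint ℝ) := by
    intro x
    rw [map_mul moebiusQI, mul_assoc, boundaryHom_mul_apply, hφ,
      boundaryHom_moebiusQI (tendsto_toSL2R_smul a (φ x))]
    rfl
  obtain ⟨ψ, hc, hψm, hψ⟩ := exists_strictMono_boundaryMap hinf
  refine ⟨_, ψ, hinf, hc, hψm, hψ, ?_, ?_⟩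
  · refine OnePoint.coe_injective ?_
    rw [← hψ, hval]
    congr 1
    field_simp
    ring
  · refine OnePoint.coe_injective ?_
    rw [← hψ, hval]
    congr 1
    field_simp
    ring

theorem uniformPowers_of_mem {G : Subgroup QI} {A B : ℝ}
    (hG : ∀ x ∈ G, ∃ f : QIHomeo, QI.mk f = x ∧ QuasiIsometryWith A B f.1) {f : QIHomeo}
    (hf : QI.mk f ∈ G) : UniformPowers A B f := by
  intro n
  obtain ⟨g, hg, hAB⟩ := hG _ (G.pow_mem hf n)
  refine ⟨g, ?_, hAB⟩
  rw [← map_pow] at hg ⊢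
  exact QI.mk_eq_mk_iff.mp hg

theorem corollary4p2 (G : Subgroup QI) (hG : IsUniformQIGroup G) (hPSL : PSL2R ≤ G) :
    G = PSL2R := by
  refine le_antisymm (fun x hx => ?_) hPSL
  obtain ⟨A, B, hA, hB, hG⟩ := hG
  obtain ⟨f, rfl, -⟩ := hG x hx
  obtain ⟨g, φ, hi, hc, hm, hφ, h0, h1⟩ := exists_moebiusQI_normalise f
  have hgP : QI.mk (moebiusQI g) ∈ PSL2R := ⟨g, rfl⟩
  -- Because `G` contains the Möbius transformations, the normalised map stays in `G`, and all its
  -- powers share the constants `A` and `B`.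
  have hmem : QI.mk (moebiusQI g * f) ∈ G := by
    rw [map_mul]
    exact G.mul_mem (hPSL hgP) hx
  have hmem' : QI.mk (moebiusQI g * f)⁻¹ ∈ G := by
    rw [map_inv]
    exact G.inv_mem hmem
  have h := (uniformPowers_of_mem hG hmem).boundaryHom_eq_one hA hB.le
    (uniformPowers_of_mem hG hmem') hi hφ hm hc h0 h1
  rw [← map_one boundaryHom, ← QI.mk_eq_mk_iff, map_mul, map_one] at h
  rw [eq_inv_of_mul_eq_one_right h]
  exact PSL2R.inv_mem hgP
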